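/- Let $\gamma\in\mathbb R\setminus\{0,-1,-2,\dots\}$, let $\lambda_1,\dots,\lambda_k$ be distinct non-zero real numbers, let $(\gamma)_0=1$, $(\gamma)_l=\gamma(\gamma+1)\cdots(\gamma+l-1)$, and put $$E_\gamma(z)=\sum_{l=0}^\infty\frac{z^l}{(\gamma)_l},\qquad G_\gamma(x;\lambda)=\sum_{l=0}^\infty\frac{\lambda^l}{(\gamma)_l}\cos lx,$$ $$\mathbf E_{k,\gamma}=\{E_\gamma(\lambda_jz)\}_{j=1}^k,\qquad \mathbf G_{k,\gamma}=\{G_\gamma(x;\lambda_j)\}_{j=1}^k .$$ For $n\in\mathbb Z_{\ge0}$ and $\vec m=(m_1,\dots,m_k)\in\mathbb Z^k_{\ge0}$ let $m=m_1+\dots+m_k$ and $n_j=n+m-m_j$. *Definitions.* (a) Hermite–Padé polynomials of $\mathbf E_{k,\gamma}$ for $(n,\vec m)$ are polynomials $Q\not\equiv0$, $P_1,\dots,P_k$ with $\deg Q\le m$, $\deg P_j\le n_j$ and $Q(z)E_\gamma(\lambda_jz)-P_j(z)=O(z^{n+m+1})$ for $j=1,\dots,k$. (b) Trigonometric Hermite–Padé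 polynomials of $\mathbf G_{k,\gamma}$ for $(n,\vec m)$ are trigonometric polynomials (with complex coefficients) $Q^t\not\equiv0$, $P^t_1,\dots,P^t_k$ of degrees at most $m,n_1,\dots,n_k$, such that for each $j$ the function $Q^t(x)G_\gamma(x;\lambda_j)-P^t_j(x)$ is the sum of an everywhere convergent trigonometric series $\sum_{l\ge n+m+1}(\tilde a_l\cos lx+\tilde b_l\sin lx)$; the fractions $P^t_j/Q^t$ are then called trigonometric Hermite–Padé approximations. (c) The fractions $\widehat P^t_j/\widehat Q^t$, $j=1,\dots,k$, where $\widehat Q^t,\widehat P^t_1,\dots,\widehat P^t_k$ are trigonometric polynomials of degrees at most $m,n_1,\dots,n_k$ and $\widehat Q^t$ has no real zeros, are called trigonometric Hermite–Jacobi approximations of $\mathbf G_{k,\gamma}$ for $(n,\vec m)$ if each $\widehat P^t_j/\widehat Q^t$ is the sum of an everywhere convergent trigonometric series and $G_\gamma(x;\lambda_j)-\widehat P^t_j(x)/\widehat Q^t(x)$ is the sum of an everywhere convergent series $\sum_{l\ge n+m+1}(\tilde a_l\cos lx+\tilde b_l\sin lx)$ for each $j$. **Theorem.** There is $n_0$ (depending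 only on $k$, $\gamma$ and $\lambda_1,\dots,\lambda_k$) such that for all $n\ge n_0$ and all $\vec m\ne(0,\dots,0)$ with $m_j\le n$ $(j=1,\dots,k)$ the following holds. The Hermite–Padé polynomial $Q$ of $\mathbf E_{k,\gamma}$ for $(n,\vec m)$ is unique up to a constant factor and can be normalized by $Q(0)=1$; denote it then by $Q_m(z;\mathbf E_{k,\gamma})$. There exist trigonometric Hermite–Jacobi approximations $\widehat\pi^t_j=\widehat P^t_j/\widehat Q^t_m$ of $\mathbf G_{k,\gamma}$ for $(n,\vec m)$ whose common denominator is, for all real $x$, $$\widehat Q^t_m(x)=Q_m(e^{ix};\mathbf E_{k,\gamma})\,\overline{Q_m(e^{ix};\mathbf E_{k,\gamma})}.$$ With $U_\gamma(t)=t^{n+\gamma-1}\prod_{p=1}^k(t-\lambda_p)^{m_p}$ one has $$\widehat Q^t_m(x)=\frac1{\Gamma(n+m+\gamma)^2}\left|\int_0^{+\infty}U_\gamma(t)\,e^{-te^{ix}}\,dt\right|^2,$$ where the integral is an absolutely convergent integral over the positive half-line if $\cos x>0$, and, for every real $x$, the equality holds with the absolutely convergent integral over the ray $t=se^{-ix}$,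 $s>0$ (with the principal branch of $t^{n+\gamma-1}$). If in addition $0<\lambda_1<\dots<\lambda_k$, then for at least one $j$ the function $\widehat\pi^t_j$ is not a trigonometric Hermite–Padé approximation, that is, it does not coincide with $P^t_j/Q^t$ for any trigonometric Hermite–Padé polynomials $(Q^t,P^t_1,\dots,P^t_k)$ of $\mathbf G_{k,\gamma}$ for $(n,\vec m)$. -/

import Mathlib

open Polynomial Filter Topology MeasureTheory

noncomputable section

/-! ### Algebraic Hermite–Padé polynomials -/

/-- The coefficient `μ ^ l / (γ)_l`, where `(γ)_l = γ (γ + 1) ⋯ (γ + l - 1)`. -/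
def mlCoeff (γ μ : ℝ) (l : ℕ) : ℝ := μ ^ l / (ascPochhammer ℝ l).eval γ

/-- The system `E_{k,γ}`: the power series of `E_γ (λ_j z) = ∑ λ_j ^ p z ^ p / (γ)_p`. -/
def systemE {k : ℕ} (γ : ℝ) (lam : Fin k → ℝ) (j : Fin k) : PowerSeries ℂ :=
  PowerSeries.mk fun p => ((mlCoeff γ (lam j) p : ℝ) : ℂ)

/-- `(Q, P)` are Hermite–Padé polynomials of the system `f` of power series for the multi-index
`(n, m)`: with `|m| = ∑ m_j`, `Q ≠ 0` has degree at most `|m|`, `P j` has degree at most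
`n_j = n + |m| - m_j`, and `Q f_j - P_j = O(z ^ (n + |m| + 1))`. -/
def IsHermitePade {k : ℕ} (f : Fin k → PowerSeries ℂ) (n : ℕ) (m : Fin k → ℕ)
    (Q : ℂ[X]) (P : Fin k → ℂ[X]) : Prop :=
  Q ≠ 0 ∧ Q.natDegree ≤ ∑ i, m i ∧
    ∀ j, (P j).natDegree ≤ n + ∑ i, m i - m j ∧
      ∀ l ≤ n + ∑ i, m i,
        PowerSeries.coeff l ((Q : PowerSeries ℂ) * f j - (P j : PowerSeries ℂ)) = 0

/-! ### Trigonometric polynomials and series -/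

/-- `T` is a trigonometric polynomial of degree at most `d`, with complex coefficients. -/
def IsTrigPoly (d : ℕ) (T : ℝ → ℂ) : Prop :=
  ∃ u : ℤ → ℂ, ∀ x : ℝ,
    T x = ∑ p ∈ Finset.Icc (-(d : ℤ)) (d : ℤ), u p * Complex.exp (Complex.I * p * x)

/-- `g` is the sum of an everywhere convergent trigonometric series
`∑_{l ≥ N} (a_l cos l x + b_l sin l x)` with complex coefficients. -/
def IsTrigSeriesFrom (N : ℕ) (g : ℝ → ℂ) : Prop :=
  ∃ a b : ℕ → ℂ, ∀ x : ℝ,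
    Tendsto (fun L : ℕ => ∑ l ∈ Finset.Ico N L,
      (a l * (Real.cos (l * x) : ℂ) + b l * (Real.sin (l * x) : ℂ))) atTop (𝓝 (g x))

/-- `(Q, P)` are trigonometric Hermite–Padé polynomials of `f` for `(n, m)`. -/
def IsTrigHermitePade {k : ℕ} (f : Fin k → ℝ → ℝ) (n : ℕ) (m : Fin k → ℕ)
    (Q : ℝ → ℂ) (P : Fin k → ℝ → ℂ) : Prop :=
  Q ≠ 0 ∧ IsTrigPoly (∑ i, m i) Q ∧
    ∀ j, IsTrigPoly (n + ∑ i, m i - m j) (P j) ∧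
      IsTrigSeriesFrom (n + ∑ i, m i + 1) (fun x => Q x * (f j x : ℂ) - P j x)

/-- The function `r` is a `j`-th trigonometric Hermite–Padé approximation of `f` for `(n, m)`:
it is the fraction `P_j / Q` for some trigonometric Hermite–Padé polynomials `(Q, P)`. -/
def IsTrigHermitePadeApprox {k : ℕ} (f : Fin k → ℝ → ℝ) (n : ℕ) (m : Fin k → ℕ)
    (j : Fin k) (r : ℝ → ℂ) : Prop :=
  ∃ (Q : ℝ → ℂ) (P : Fin k → ℝ → ℂ), IsTrigHermitePade f n m Q P ∧
    ∀ x, Q x ≠ 0 → r x = P j x / Q x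

/-- The fractions `P_j / Q` are the trigonometric Hermite–Jacobi approximations of `f` for
`(n, m)` (and `(Q, P)` the corresponding polynomials). The fractions are functions on the whole
real line, so the denominator has no real zeros. -/
def IsTrigHermiteJacobi {k : ℕ} (f : Fin k → ℝ → ℝ) (n : ℕ) (m : Fin k → ℕ)
    (Q : ℝ → ℂ) (P : Fin k → ℝ → ℂ) : Prop :=
  (∀ x, Q x ≠ 0) ∧ IsTrigPoly (∑ i, m i) Q ∧
    ∀ j, IsTrigPoly (n + ∑ i, m i - m j) (P j) ∧
      IsTrigSeriesFrom 0 (fun x => P j x / Q x) ∧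
      IsTrigSeriesFrom (n + ∑ i, m i + 1) (fun x => (f j x : ℂ) - P j x / Q x)

/-! ### The trigonometric system and the kernel of the integral representation -/

/-- The system `G_{k,γ}`: `G_γ (x; λ_j) = ∑ λ_j ^ l / (γ)_l cos l x`. -/
def systemG {k : ℕ} (γ : ℝ) (lam : Fin k → ℝ) (j : Fin k) (x : ℝ) : ℝ :=
  ∑' l : ℕ, mlCoeff γ (lam j) l * Real.cos (l * x)

/-- `U_γ (t) = t ^ (n + γ - 1) ∏ (t - λ_p) ^ (m_p)`, with the principal branch of the power. -/
def kernelU {k : ℕ} (γ : ℝ) (lam : Fin k → ℝ) (n : ℕ) (m : Fin k → ℕ) (t : ℂ) : ℂ :=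
  t ^ ((n : ℂ) + (γ : ℂ) - 1) * ∏ p, (t - (lam p : ℂ)) ^ m p

/-- The series that define `G_γ` converge absolutely. -/
theorem summable_systemG (γ μ x : ℝ) :
    Summable fun l : ℕ => mlCoeff γ μ l * Real.cos (l * x) := by
  have hs : ∀ l : ℕ, mlCoeff γ μ (l + 1) = mlCoeff γ μ l * (μ / (γ + l)) := by
    intro l
    simp only [mlCoeff, ascPochhammer_succ_right, Polynomial.eval_mul, Polynomial.eval_add,
      Polynomial.eval_X, Polynomial.eval_natCast, pow_succ]
    rw [mul_div_mul_comm]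
  have ht : Tendsto (fun l : ℕ => |μ| / |γ + l|) atTop (𝓝 0) := by
    refine Tendsto.div_atTop tendsto_const_nhds ?_
    exact tendsto_abs_atTop_atTop.comp
      (tendsto_atTop_add_const_left _ _ tendsto_natCast_atTop_atTop)
  have h1 : Summable fun l : ℕ => mlCoeff γ μ l := by
    refine summable_of_ratio_norm_eventually_le (r := 1 / 2) (by norm_num) ?_
    filter_upwards [ht.eventually (ge_mem_nhds (show (0 : ℝ) < 1 / 2 by norm_num))] with l hl
    rw [hs, norm_mul, norm_div, Real.norm_eq_abs μ, Real.norm_eq_abs (γ + l), mul_comm]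
    exact mul_le_mul_of_nonneg_right hl (norm_nonneg _)
  refine Summable.of_norm_bounded h1.norm ?_
  intro l
  rw [norm_mul]
  exact mul_le_of_le_one_right (norm_nonneg _) (Real.abs_cos_le_one _)

end

/-! ### Uniqueness of everywhere convergent trigonometric series -/

/-! Write M = ∑ m_i. The degree bound on P_j turns the Hermite–Padé condition into the vanishing of
m_j consecutive coefficients of Q · E_γ(λ_j z). Weighting the reversed coefficients of Q by
(γ)_{n+M} / (γ)_{n+p} gives a polynomial v (`borelPoly`), and up to nonzero factors these
coefficients are the derivatives of order 0, …, m_j - 1 of t^{n+γ-1} v(t) at λ_j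
(`coeff_coe_mul_systemE`). So the condition says that (t - λ_j)^{m_j} divides v for every j. As deg
v ≤ M, v is a multiple of ∏ (t - λ_p)^{m_p}. This gives existence, uniqueness, explicit coefficients
and, through Γ(γ + l) = (γ)_l Γ(γ), the integral formulas.

For large n, uniformly in m, Q has no zeros in the closed unit disc: with s = (∑ m_j λ_j) / (n + M +
γ) the polynomial Q' + s Q is small there, so e^{sz} Q(z) stays close to its value 1 at zero
(`hermitePadeDen_eval_ne_zero`). Then 1/Q has absolutely summable coefficients, and so has R_j =
E_γ(λ_j z) - P_j / Q, which starts at z^{n+M+1}. Real parts on the unit circle give the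
Hermite–Jacobi approximations Re(P_j / Q) = Re(P_j conj Q) / |Q|².

Suppose that Re(P_j / Q) = T_j / S for trigonometric Hermite–Padé polynomials. Then S · Re R_j has
no frequencies below n + M + 1. If R_j has a nonzero leading coefficient, a triangular system forces
S to be constant; but then S · G still has the frequency n + M, which T_j cannot cancel when m_j >
0. The leading coefficient is a nonzero multiple of ∫_0^{λ_j} t^{n+γ-1} ∏ (t - λ_p)^{m_p} dt, where
the integrand keeps its sign if λ_j is the smallest node with m_j ≠ 0. The series in the definition
are only assumed to converge everywhere, so comparing their coefficients requires Cantor's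
uniqueness theorem (`coeff_eq_zero_of_tendsto`), proved by Riemann's method. -/

theorem sinc_natCast_div_antitone {l K : ℕ} (hl : l < K) :
    Real.sinc ((l + 1 : ℕ) / K) ^ 2 ≤ Real.sinc (l / K) ^ 2 := by
  have hK : (0 : ℝ) < K := by exact_mod_cast (Nat.zero_le l).trans_lt hl
  have hs0 : 0 < ((l + 1 : ℕ) : ℝ) / K := by positivity
  have hs1 : ((l + 1 : ℕ) : ℝ) / K ≤ 1 := by
    rw [div_le_one hK]; exact_mod_cast hl
  have hpi : (1 : ℝ) ≤ Real.pi := by linarith [Real.two_le_pi]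
  set s : ℝ := ((l + 1 : ℕ) : ℝ) / K with hs
  have hsin : 0 ≤ Real.sin s := Real.sin_nonneg_of_nonneg_of_le_pi hs0.le (hs1.trans hpi)
  rcases Nat.eq_zero_or_pos l with rfl | hlpos
  · have := Real.abs_sinc_le_one s
    simpa using this
  set t : ℝ := (l : ℝ) / K with ht
  have ht0 : 0 < t := by positivity
  have hts : t ≤ s := by
    rw [hs, ht]; gcongr; simp
  rw [Real.sinc_of_ne_zero hs0.ne', Real.sinc_of_ne_zero ht0.ne']
  refine pow_le_pow_left₀ (by positivity) ?_ 2
  rw [div_le_div_iff₀ hs0 ht0]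
  have hconc := strictConcaveOn_sin_Icc.concaveOn.2
    (show (0 : ℝ) ∈ Set.Icc 0 Real.pi from ⟨le_rfl, Real.pi_pos.le⟩)
    (show s ∈ Set.Icc 0 Real.pi from ⟨hs0.le, hs1.trans hpi⟩)
    (show 0 ≤ 1 - t / s by rw [sub_nonneg, div_le_one hs0]; exact hts)
    (show 0 ≤ t / s by positivity) (by ring)
  simp only [smul_eq_mul, Real.sin_zero, mul_zero, zero_add] at hconc
  rw [div_mul_cancel₀ _ hs0.ne', div_mul_eq_mul_div, div_le_iff₀ hs0] at hconc
  linarith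

theorem abs_sinc_sub_sinc_le {t s : ℝ} (ht : 0 < t) (hts : t ≤ s) :
    |Real.sinc s - Real.sinc t| ≤ 2 * (s - t) / s := by
  have hs : 0 < s := ht.trans_le hts
  rw [Real.sinc_of_ne_zero hs.ne', Real.sinc_of_ne_zero ht.ne']
  have h1 : Real.sin s / s - Real.sin t / t
      = (Real.sin s - Real.sin t) / s - Real.sin t / t * ((s - t) / s) := by
    field_simp; ring
  rw [h1]
  refine (abs_sub _ _).trans ?_
  have h2 : |(Real.sin s - Real.sin t) / s| ≤ (s - t) / s := by
    rw [abs_div, abs_of_pos hs]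
    gcongr
    have := Real.abs_sin_sub_sin_le s t
    rwa [abs_of_nonneg (sub_nonneg.2 hts)] at this
  have h3 : |Real.sin t / t * ((s - t) / s)| ≤ (s - t) / s := by
    rw [abs_mul, ← Real.sinc_of_ne_zero ht.ne',
      abs_of_nonneg (div_nonneg (sub_nonneg.2 hts) hs.le)]
    exact mul_le_of_le_one_left (div_nonneg (sub_nonneg.2 hts) hs.le) (Real.abs_sinc_le_one t)
  calc _ ≤ (s - t) / s + (s - t) / s := add_le_add h2 h3
    _ = _ := by ring

/-- The bound 4K / (l (l + 1)) is written as a difference so that it telescopes in the tail of the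
variation. -/
theorem abs_sinc_sq_sub_le {l K : ℕ} (hK : 0 < K) (hl : 0 < l) :
    |Real.sinc ((l + 1 : ℕ) / K) ^ 2 - Real.sinc (l / K) ^ 2|
      ≤ 4 * K * (1 / l - 1 / (l + 1 : ℕ)) := by
  have hK' : (0 : ℝ) < K := by exact_mod_cast hK
  have hl' : (0 : ℝ) < l := by exact_mod_cast hl
  have ht : (0 : ℝ) < l / K := by positivity
  have hts : (l : ℝ) / K ≤ (l + 1 : ℕ) / K := by gcongr; simp
  have h1 := abs_sinc_sub_sinc_le ht hts
  have ht' : |Real.sinc (l / K)| ≤ K / l := by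
    rw [Real.sinc_of_ne_zero ht.ne', abs_div, abs_of_pos ht, div_le_div_iff₀ ht hl']
    have := Real.abs_sin_le_one ((l : ℝ) / K)
    calc |Real.sin (l / K)| * l ≤ 1 * l := by gcongr
      _ = K * (l / K) := by field_simp
  have hs' : |Real.sinc ((l + 1 : ℕ) / K)| ≤ K / l := by
    have hs : (0 : ℝ) < (l + 1 : ℕ) / K := by positivity
    rw [Real.sinc_of_ne_zero hs.ne', abs_div, abs_of_pos hs, div_le_div_iff₀ hs hl']
    have := Real.abs_sin_le_one (((l + 1 : ℕ) : ℝ) / K)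
    calc |Real.sin ((l + 1 : ℕ) / K)| * l ≤ 1 * l := by gcongr
      _ = K * (l / K) := by field_simp
      _ ≤ K * ((l + 1 : ℕ) / K) := by gcongr
  have h2 : |Real.sinc ((l + 1 : ℕ) / K) + Real.sinc (l / K)| ≤ 2 * (K / l) := by
    refine (abs_add_le _ _).trans ?_
    linarith
  rw [sq_sub_sq, abs_mul]
  calc _ ≤ 2 * (K / l) * (2 * (((l + 1 : ℕ) : ℝ) / K - l / K) / ((l + 1 : ℕ) / K)) := by
        gcongr
    _ = _ := by push_cast; field_simp; ring

/-- The variation of the Riemann weights is bounded uniformly in `K`: they decrease up to `l = K`,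
which contributes at most 1, and the telescoping tail contributes at most 4. -/
theorem sum_abs_sinc_sq_sub_le (K L : ℕ) (hK : 0 < K) :
    ∑ l ∈ Finset.range L, |Real.sinc ((l + 1 : ℕ) / K) ^ 2 - Real.sinc (l / K) ^ 2| ≤ 5 := by
  have hfirst : ∀ L ≤ K, ∑ l ∈ Finset.range L,
      |Real.sinc ((l + 1 : ℕ) / K) ^ 2 - Real.sinc (l / K) ^ 2| ≤ 1 := by
    intro L hL
    have : ∀ l ∈ Finset.range L, |Real.sinc ((l + 1 : ℕ) / K) ^ 2 - Real.sinc (l / K) ^ 2|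
        = Real.sinc (l / K) ^ 2 - Real.sinc ((l + 1 : ℕ) / K) ^ 2 := by
      intro l hl
      rw [abs_sub_comm, abs_of_nonneg]
      exact sub_nonneg.2 (sinc_natCast_div_antitone ((Finset.mem_range.1 hl).trans_le hL))
    rw [Finset.sum_congr rfl this,
      Finset.sum_range_sub' (fun l : ℕ => Real.sinc ((l : ℝ) / K) ^ 2)]
    simp only [Nat.cast_zero, zero_div, Real.sinc_zero, one_pow]
    linarith [sq_nonneg (Real.sinc ((L : ℝ) / K))]
  rcases le_total L K with hL | hL
  · linarith [hfirst L hL]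
  obtain ⟨j, rfl⟩ := Nat.exists_eq_add_of_le hL
  rw [Finset.sum_range_add]
  have hK' : (0 : ℝ) < K := by exact_mod_cast hK
  have : ∑ i ∈ Finset.range j, |Real.sinc ((K + i + 1 : ℕ) / K) ^ 2
      - Real.sinc ((K + i : ℕ) / K) ^ 2| ≤ 4 := by
    calc _ ≤ ∑ i ∈ Finset.range j, 4 * K * ((1 : ℝ) / (K + i : ℕ) - 1 / (K + i + 1 : ℕ)) := by
          exact Finset.sum_le_sum fun i _ => abs_sinc_sq_sub_le hK (by omega)
      _ = 4 * K * (1 / (K : ℝ) - 1 / (K + j : ℕ)) := by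
          rw [← Finset.mul_sum]
          congr 1
          have := Finset.sum_range_sub' (fun i : ℕ => (1 : ℝ) / (K + i : ℕ)) j
          simpa [add_assoc] using this
      _ ≤ 4 * K * (1 / (K : ℝ)) := by
          gcongr
          simp only [sub_le_self_iff]; positivity
      _ = 4 := by field_simp
  linarith [hfirst K le_rfl]

/-- Riemann summability of a convergent series. -/
theorem tendsto_tsum_mul_sinc_sq {B : ℕ → ℂ}
    (hB : Tendsto (fun L => ∑ l ∈ Finset.range L, B l) atTop (𝓝 0)) {R : ℕ → ℂ}
    (hR : ∀ K : ℕ, 0 < K → HasSum (fun l : ℕ => B l * ((Real.sinc (l / K) ^ 2 : ℝ) : ℂ)) (R K)) :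
    Tendsto R atTop (𝓝 0) := by
  set S : ℕ → ℂ := fun L => ∑ l ∈ Finset.range L, B l with hS
  rw [Metric.tendsto_atTop]
  intro ε hε
  -- After Abel summation three pieces remain: the boundary term (at most ε/12), the first `M`
  -- differences (at most ε/4 for large `K`), and the rest (at most ε/12 times the variation bound
  -- 5). Together they give 3ε/4.
  obtain ⟨M, hM⟩ := (Metric.tendsto_atTop.1 hB) (ε / 12) (by positivity)
  have hd : Tendsto (fun K : ℕ => ∑ l ∈ Finset.range M, ‖S (l + 1)‖ *
      |Real.sinc ((l + 1 : ℕ) / K) ^ 2 - Real.sinc (l / K) ^ 2|) atTop (𝓝 0) := by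
    have h0 : ∀ l : ℕ, Tendsto (fun K : ℕ => Real.sinc ((l : ℝ) / K) ^ 2) atTop (𝓝 1) := by
      intro l
      have : Tendsto (fun K : ℕ => (l : ℝ) / K) atTop (𝓝 0) :=
        tendsto_const_div_atTop_nhds_zero_nat _
      have h := ((Real.continuous_sinc.tendsto 0).comp this).pow 2
      simpa using h
    have := tendsto_finsetSum (Finset.range M) (fun l _ =>
      ((((h0 (l + 1)).sub (h0 l)).abs).const_mul ‖S (l + 1)‖))
    simpa using this
  obtain ⟨K₀, hK₀⟩ := (Metric.tendsto_atTop.1 hd) (ε / 4) (by positivity)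
  refine ⟨max K₀ 1, fun K hK => ?_⟩
  have hKpos : 0 < K := lt_of_lt_of_le one_pos ((le_max_right _ _).trans hK)
  have hK1 := hK₀ K ((le_max_left _ _).trans hK)
  rw [Real.dist_eq, sub_zero] at hK1
  replace hK1 := (abs_lt.1 hK1).2
  set φ : ℕ → ℝ := fun l => Real.sinc (l / K) ^ 2 with hφ
  have hbound : ∀ L ≥ M + 1, ‖∑ l ∈ Finset.range L, B l * (φ l : ℂ)‖ ≤ 3 * ε / 4 := by
    intro L hL
    have hparts := Finset.sum_range_by_parts (fun l => (φ l : ℂ)) B L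
    simp only [smul_eq_mul] at hparts
    have e1 : ∑ l ∈ Finset.range L, B l * (φ l : ℂ) = ∑ l ∈ Finset.range L, (φ l : ℂ) * B l :=
      Finset.sum_congr rfl fun l _ => mul_comm _ _
    rw [e1, hparts]
    obtain ⟨j, rfl⟩ : ∃ j, L = M + j + 1 := ⟨L - (M + 1), by omega⟩
    have hlast : ‖(φ (M + j + 1 - 1) : ℂ) * ∑ i ∈ Finset.range (M + j + 1), B i‖ ≤ ε / 12 := by
      rw [norm_mul]
      have h1 := hM (M + j + 1) (by omega)
      rw [dist_zero_right] at h1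
      have h2 : ‖(φ (M + j + 1 - 1) : ℂ)‖ ≤ 1 := by
        rw [Complex.norm_real, Real.norm_eq_abs, hφ, abs_pow]
        exact pow_le_one₀ (abs_nonneg _) (Real.abs_sinc_le_one _)
      calc _ ≤ 1 * (ε / 12) := by gcongr
        _ = _ := one_mul _
    have hmain : ‖∑ i ∈ Finset.range (M + j + 1 - 1), ((φ (i + 1) : ℂ) - φ i) *
        ∑ l ∈ Finset.range (i + 1), B l‖ ≤ ε / 4 + 5 * (ε / 12) := by
      have hterm : ∀ i, ‖((φ (i + 1) : ℂ) - φ i) * ∑ l ∈ Finset.range (i + 1), B l‖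
          = ‖S (i + 1)‖ * |φ (i + 1) - φ i| := by
        intro i
        rw [norm_mul, ← Complex.ofReal_sub, Complex.norm_real, Real.norm_eq_abs, mul_comm]
      refine (norm_sum_le _ _).trans ?_
      simp only [hterm]
      rw [show M + j + 1 - 1 = M + j by omega, Finset.sum_range_add]
      refine add_le_add hK1.le ?_
      calc _ ≤ ∑ x ∈ Finset.range j, (ε / 12) * |φ (M + x + 1) - φ (M + x)| := by
            refine Finset.sum_le_sum fun x _ => ?_
            have h1 := hM (M + x + 1) (by omega)
            rw [dist_zero_right] at h1
            gcongr
        _ ≤ ∑ x ∈ Finset.range (M + j), (ε / 12) * |φ (x + 1) - φ x| := by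
            rw [Finset.sum_range_add]
            refine le_add_of_nonneg_left (Finset.sum_nonneg fun _ _ => by positivity)
        _ = (ε / 12) * ∑ x ∈ Finset.range (M + j), |φ (x + 1) - φ x| := by rw [Finset.mul_sum]
        _ ≤ (ε / 12) * 5 := by
            gcongr
            exact sum_abs_sinc_sq_sub_le K (M + j) hKpos
        _ = _ := by ring
    refine (norm_sub_le _ _).trans ?_
    linarith
  have hlim := (hR K hKpos).tendsto_sum_nat.norm
  rw [dist_zero_right]
  have := le_of_tendsto hlim ((eventually_ge_atTop (M + 1)).mono hbound)
  linarith

/-! ### Schwarz's theorem on the second symmetric derivative -/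

/-- A function that vanishes at the ends of an interval and whose second symmetric differences
have positive limits inside has no positive value. -/
theorem nonpos_of_second_difference_pos {f : ℝ → ℝ} (hf : Continuous f) {a b : ℝ} (hab : a ≤ b)
    (ha : f a = 0) (hb : f b = 0) {h : ℕ → ℝ} (hpos : ∀ᶠ K in atTop, 0 < h K)
    (h0 : Tendsto h atTop (𝓝 0)) {d : ℝ} (hd : 0 < d)
    (hlim : ∀ x, Tendsto (fun K => (f (x + h K) + f (x - h K) - 2 * f x) / h K ^ 2) atTop (𝓝 d))
    {x : ℝ} (hx : x ∈ Set.Icc a b) : f x ≤ 0 := by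
  by_contra! hfx
  obtain ⟨y, hy, hmax⟩ := isCompact_Icc.exists_isMaxOn (Set.nonempty_Icc.2 hab) hf.continuousOn
  have hfy : 0 < f y := hfx.trans_le (hmax hx)
  have hya : a < y := lt_of_le_of_ne hy.1 (by rintro rfl; exact hfy.ne' ha)
  have hyb : y < b := lt_of_le_of_ne hy.2 (by rintro rfl; exact hfy.ne' hb)
  have hsmall : ∀ᶠ K in atTop, h K < min (y - a) (b - y) :=
    h0.eventually (gt_mem_nhds (lt_min (sub_pos.2 hya) (sub_pos.2 hyb)))
  have hle : d ≤ 0 := by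
    refine le_of_tendsto (hlim y) ?_
    filter_upwards [hpos, hsmall] with K hK1 hK2
    have h1 := (lt_min_iff.1 hK2).1
    have h2 := (lt_min_iff.1 hK2).2
    have m1 : f (y + h K) ≤ f y := hmax ⟨by linarith, by linarith⟩
    have m2 : f (y - h K) ≤ f y := hmax ⟨by linarith, by linarith⟩
    exact div_nonpos_of_nonpos_of_nonneg (by linarith) (sq_nonneg _)
  linarith

/-- Schwarz: a continuous function with vanishing second symmetric derivative is affine. -/
theorem affine_le_of_second_difference_zero {f : ℝ → ℝ} (hf : Continuous f) {h : ℕ → ℝ}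
    (hpos : ∀ᶠ K in atTop, 0 < h K) (h0 : Tendsto h atTop (𝓝 0))
    (hlim : ∀ x, Tendsto (fun K => (f (x + h K) + f (x - h K) - 2 * f x) / h K ^ 2) atTop (𝓝 0))
    {a b x : ℝ} (hab : a < b) (hx : x ∈ Set.Icc a b) :
    f x ≤ f a + (f b - f a) / (b - a) * (x - a) := by
  have hba : b - a ≠ 0 := (sub_pos.2 hab).ne'
  have key : ∀ ε > 0, f x ≤ f a + (f b - f a) / (b - a) * (x - a) + ε * ((x - a) * (b - x)) := by
    intro ε hε
    -- Subtracting the parabola raises the second symmetric derivative from 0 to 2ε > 0, which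
    -- excludes a positive interior maximum; afterwards ε tends to 0.
    set g : ℝ → ℝ := fun y => f y - (f a + (f b - f a) / (b - a) * (y - a))
      - ε * ((y - a) * (b - y)) with hg
    have := nonpos_of_second_difference_pos (f := g) (by fun_prop) hab.le (by simp [hg])
      (by simp only [hg, div_mul_cancel₀ _ hba]; ring) hpos h0 (d := 2 * ε) (by positivity) ?_ hx
    · simp only [hg] at this
      linarith
    · intro y
      have h2 := (hlim y).add_const (2 * ε)
      rw [zero_add] at h2
      refine h2.congr' ?_
      filter_upwards [hpos] with K hK
      simp only [hg]
      field_simp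
      ring
  have ht : Tendsto (fun ε : ℝ => f a + (f b - f a) / (b - a) * (x - a) + ε * ((x - a) * (b - x)))
      (𝓝[>] 0) (𝓝 (f a + (f b - f a) / (b - a) * (x - a) + 0 * ((x - a) * (b - x)))) :=
    tendsto_nhdsWithin_of_tendsto_nhds
      ((by fun_prop : Continuous fun ε : ℝ =>
        f a + (f b - f a) / (b - a) * (x - a) + ε * ((x - a) * (b - x))).tendsto 0)
  have := ge_of_tendsto ht (by filter_upwards [self_mem_nhdsWithin] with ε hε using key ε hε)
  linarith

theorem affine_of_second_difference_zero {f : ℝ → ℝ} (hf : Continuous f) {h : ℕ → ℝ}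
    (hpos : ∀ᶠ K in atTop, 0 < h K) (h0 : Tendsto h atTop (𝓝 0))
    (hlim : ∀ x, Tendsto (fun K => (f (x + h K) + f (x - h K) - 2 * f x) / h K ^ 2) atTop (𝓝 0))
    {a b x : ℝ} (hab : a < b) (hx : x ∈ Set.Icc a b) :
    f x = f a + (f b - f a) / (b - a) * (x - a) := by
  refine le_antisymm (affine_le_of_second_difference_zero hf hpos h0 hlim hab hx) ?_
  have := affine_le_of_second_difference_zero (f := fun y => -f y) hf.neg hpos h0 (fun y => by
    have := (hlim y).neg
    rw [neg_zero] at this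
    refine this.congr fun K => ?_
    ring) hab hx
  have e : (-f b - -f a) / (b - a) * (x - a) = -((f b - f a) / (b - a) * (x - a)) := by ring
  rw [e] at this
  linarith

theorem affine_of_second_difference_zero_complex {f : ℝ → ℂ} (hf : Continuous f) {h : ℕ → ℝ}
    (hpos : ∀ᶠ K in atTop, 0 < h K) (h0 : Tendsto h atTop (𝓝 0))
    (hlim : ∀ x, Tendsto (fun K => (f (x + h K) + f (x - h K) - 2 * f x) / ((h K : ℝ) : ℂ) ^ 2)
      atTop (𝓝 0))
    {a b x : ℝ} (hab : a < b) (hx : x ∈ Set.Icc a b) :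
    f x = f a + (f b - f a) / ((b - a : ℝ) : ℂ) * ((x - a : ℝ) : ℂ) := by
  have hre := affine_of_second_difference_zero (f := fun y => (f y).re)
    (Complex.continuous_re.comp hf) hpos h0 (fun y => by
      have := (Complex.continuous_re.tendsto 0).comp (hlim y)
      rw [Complex.zero_re] at this
      refine this.congr fun K => ?_
      simp only [Function.comp]
      rw [← Complex.ofReal_pow, Complex.div_ofReal_re]
      simp) hab hx
  have him := affine_of_second_difference_zero (f := fun y => (f y).im)
    (Complex.continuous_im.comp hf) hpos h0 (fun y => by
      have := (Complex.continuous_im.tendsto 0).comp (hlim y)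
      rw [Complex.zero_im] at this
      refine this.congr fun K => ?_
      simp only [Function.comp]
      rw [← Complex.ofReal_pow, Complex.div_ofReal_im]
      simp) hab hx
  apply Complex.ext
  · rw [hre, Complex.add_re, Complex.re_mul_ofReal, Complex.div_ofReal_re, Complex.sub_re]
  · rw [him, Complex.add_im, Complex.im_mul_ofReal, Complex.div_ofReal_im, Complex.sub_im]

/-! ### Exponentials, the Cantor–Lebesgue bound and Cantor's theorem -/

/-- The exponential `e ^ {i p x}`. -/
noncomputable def cexpI (p : ℤ) (x : ℝ) : ℂ := Complex.exp (Complex.I * p * x)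

theorem cexpI_add (p q : ℤ) (x : ℝ) : cexpI (p + q) x = cexpI p x * cexpI q x := by
  simp only [cexpI, ← Complex.exp_add]; push_cast; ring_nf

theorem cexpI_add_right (p : ℤ) (x y : ℝ) : cexpI p (x + y) = cexpI p x * cexpI p y := by
  simp only [cexpI, ← Complex.exp_add]; push_cast; ring_nf

theorem cexpI_neg_left (p : ℤ) (x : ℝ) : cexpI (-p) x = cexpI p (-x) := by
  simp only [cexpI]; push_cast; ring_nf

@[simp] theorem cexpI_zero (x : ℝ) : cexpI 0 x = 1 := by simp [cexpI]

@[simp] theorem cexpI_zero_right (p : ℤ) : cexpI p 0 = 1 := by simp [cexpI]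

@[simp] theorem norm_cexpI (p : ℤ) (x : ℝ) : ‖cexpI p x‖ = 1 := by
  rw [cexpI, show Complex.I * p * x = ((p * x : ℝ) : ℂ) * Complex.I by push_cast; ring,
    Complex.norm_exp_ofReal_mul_I]

theorem continuous_cexpI (p : ℤ) : Continuous (cexpI p) := by unfold cexpI; fun_prop

theorem cexpI_eq_cos_add_sin (p : ℤ) (x : ℝ) :
    cexpI p x = (Real.cos (p * x) : ℂ) + (Real.sin (p * x) : ℂ) * Complex.I := by
  rw [cexpI, show Complex.I * p * x = ((p * x : ℝ) : ℂ) * Complex.I by push_cast; ring,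
    Complex.exp_mul_I, Complex.ofReal_cos, Complex.ofReal_sin]

theorem conj_cexpI (p : ℤ) (x : ℝ) : (starRingEnd ℂ) (cexpI p x) = cexpI (-p) x := by
  simp only [cexpI, ← Complex.exp_conj, map_mul, Complex.conj_I, Complex.conj_ofReal, map_intCast]
  push_cast; ring_nf

theorem cexpI_two_pi (p : ℤ) : cexpI p (2 * Real.pi) = 1 := by
  rw [cexpI, Complex.exp_eq_one_iff]
  exact ⟨p, by push_cast; ring⟩

theorem cexpI_natCast (l : ℕ) (x : ℝ) : cexpI l x = Complex.exp (Complex.I * x) ^ l := by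
  rw [cexpI, ← Complex.exp_nat_mul]; push_cast; ring_nf

theorem integral_cexpI (p : ℤ) :
    ∫ x in (0 : ℝ)..2 * Real.pi, cexpI p x = if p = 0 then ((2 * Real.pi : ℝ) : ℂ) else 0 := by
  split_ifs with hp
  · subst hp
    simp only [cexpI_zero]
    simp
  · have hc : Complex.I * (p : ℂ) ≠ 0 :=
      mul_ne_zero Complex.I_ne_zero (by exact_mod_cast hp)
    have h := integral_exp_mul_complex (a := 0) (b := 2 * Real.pi) hc
    have h2 := cexpI_two_pi p
    rw [cexpI] at h2
    simp only [cexpI]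
    rw [h, h2]
    simp

/-- The coefficients of an absolutely convergent trigonometric series of constant sum vanish. -/
theorem coeff_eq_zero_of_hasSum_const {d : ℤ → ℂ} (hd : Summable fun p => ‖d p‖) {C : ℂ}
    (h : ∀ x ∈ Set.Icc 0 (2 * Real.pi), HasSum (fun p : ℤ => d p * cexpI p x) C) {q : ℤ}
    (hq : q ≠ 0) : d q = 0 := by
  have hpi := Real.pi_pos
  have key : HasSum (fun p : ℤ => ∫ x in (0 : ℝ)..2 * Real.pi, d p * cexpI p x * cexpI (-q) x)
      (∫ x in (0 : ℝ)..2 * Real.pi, C * cexpI (-q) x) := by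
    refine intervalIntegral.hasSum_integral_of_dominated_convergence (fun p _ => ‖d p‖) ?_ ?_ ?_ ?_
      ?_
    · intro p
      exact ((continuous_const.mul (continuous_cexpI p)).mul
        (continuous_cexpI (-q))).aestronglyMeasurable
    · intro p
      exact ae_of_all _ fun x _ => by simp
    · exact ae_of_all _ fun x _ => hd
    · exact intervalIntegrable_const
    · refine ae_of_all _ fun x hx => ?_
      rw [Set.uIoc_of_le (by positivity)] at hx
      exact (h x ⟨hx.1.le, hx.2⟩).mul_right _
  have e1 : ∀ p : ℤ, ∫ x in (0 : ℝ)..2 * Real.pi, d p * cexpI p x * cexpI (-q) x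
      = if p = q then d q * ((2 * Real.pi : ℝ) : ℂ) else 0 := by
    intro p
    simp only [mul_assoc, ← cexpI_add]
    rw [intervalIntegral.integral_const_mul, integral_cexpI]
    by_cases hpq : p = q
    · simp [hpq]
    · rw [if_neg hpq, if_neg (by omega), mul_zero]
  have e2 : ∫ x in (0 : ℝ)..2 * Real.pi, C * cexpI (-q) x = 0 := by
    rw [intervalIntegral.integral_const_mul, integral_cexpI, if_neg (by omega), mul_zero]
  simp only [e1] at key
  rw [e2] at key
  have := key.unique (hasSum_ite_eq q _)
  rcases mul_eq_zero.1 this.symm with h | h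
  · exact h
  · exact absurd h (by exact_mod_cast (by positivity : (2 * Real.pi : ℝ) ≠ 0))

theorem integral_normSq_cexpI_pair (a b : ℂ) {l : ℤ} (hl : l ≠ 0) :
    ∫ x in (0 : ℝ)..2 * Real.pi, ‖a * cexpI l x + b * cexpI (-l) x‖ ^ 2
      = 2 * Real.pi * (‖a‖ ^ 2 + ‖b‖ ^ 2) := by
  have hc : ∀ x : ℝ, ((‖a * cexpI l x + b * cexpI (-l) x‖ ^ 2 : ℝ) : ℂ)
      = ((‖a‖ ^ 2 + ‖b‖ ^ 2 : ℝ) : ℂ) + (a * (starRingEnd ℂ) b * cexpI (l + l) x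
        + b * (starRingEnd ℂ) a * cexpI (-l + -l) x) := by
    intro x
    have h1 : cexpI l x * cexpI (-l) x = 1 := by rw [← cexpI_add]; simp
    push_cast
    rw [← Complex.mul_conj', ← Complex.mul_conj', ← Complex.mul_conj', map_add, map_mul, map_mul,
      conj_cexpI, conj_cexpI, neg_neg, cexpI_add, cexpI_add]
    linear_combination (a * (starRingEnd ℂ) a + b * (starRingEnd ℂ) b) * h1
  have hI : ((∫ x in (0 : ℝ)..2 * Real.pi, ‖a * cexpI l x + b * cexpI (-l) x‖ ^ 2 : ℝ) : ℂ)
      = ((2 * Real.pi * (‖a‖ ^ 2 + ‖b‖ ^ 2) : ℝ) : ℂ) := by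
    rw [← intervalIntegral.integral_ofReal]
    simp only [hc]
    have ci : ∀ (z : ℂ) (p : ℤ), IntervalIntegrable (fun x => z * cexpI p x) volume 0
        (2 * Real.pi) := fun z p =>
      (continuous_const.mul (continuous_cexpI p)).intervalIntegrable _ _
    rw [intervalIntegral.integral_add intervalIntegrable_const ((ci _ _).add (ci _ _)),
      intervalIntegral.integral_add (ci _ _) (ci _ _), intervalIntegral.integral_const_mul,
      intervalIntegral.integral_const_mul, integral_cexpI, integral_cexpI, if_neg (by omega),
      if_neg (by omega), intervalIntegral.integral_const]
    simp
    ring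
  exact_mod_cast hI

/-- Cantor–Lebesgue. -/
theorem norm_coeff_bounded_of_tendsto {c : ℤ → ℂ}
    (h : ∀ x : ℝ, Tendsto (fun l : ℕ => c l * cexpI l x + c (-l) * cexpI (-l) x) atTop (𝓝 0)) :
    ∃ M, ∀ p : ℤ, ‖c p‖ ≤ M := by
  set D : ℕ → ℝ := fun l => ‖c l‖ ^ 2 + ‖c (-l)‖ ^ 2 with hD
  have hD0 : ∀ l, 0 ≤ D l := fun l => by positivity
  have hT : ∀ (l : ℕ) (x : ℝ), ‖c l * cexpI l x + c (-l) * cexpI (-l) x‖ ^ 2 ≤ 2 * D l := by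
    intro l x
    have h1 : ‖c l * cexpI l x + c (-l) * cexpI (-l) x‖ ≤ ‖c l‖ + ‖c (-l)‖ := by
      refine (norm_add_le _ _).trans ?_
      simp
    calc _ ≤ (‖c l‖ + ‖c (-l)‖) ^ 2 := pow_le_pow_left₀ (norm_nonneg _) h1 2
      _ ≤ _ := by simp only [hD]; nlinarith [sq_nonneg (‖c l‖ - ‖c (-l)‖)]
  -- Dividing by `1 + 2 * D l` makes the integrands bounded by 1, so dominated convergence applies
  -- without knowing that `D` is bounded. The integral equals 2π D / (1 + 2D), and once it is below
  -- π/2 it forces `D l ≤ 1`.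
  have hlim : Tendsto (fun l : ℕ => ∫ x in (0 : ℝ)..2 * Real.pi,
      ‖c l * cexpI l x + c (-l) * cexpI (-l) x‖ ^ 2 / (1 + 2 * D l)) atTop
      (𝓝 (∫ x in (0 : ℝ)..2 * Real.pi, (0 : ℝ))) := by
    refine intervalIntegral.tendsto_integral_filter_of_dominated_convergence (fun _ => 1) ?_ ?_ ?_
      ?_
    · refine Eventually.of_forall fun l => ?_
      have c1 := continuous_cexpI l
      have c2 := continuous_cexpI (-l)
      exact (by fun_prop : Continuous fun x =>
        ‖c l * cexpI l x + c (-l) * cexpI (-l) x‖ ^ 2 / (1 + 2 * D l)).aestronglyMeasurable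
    · refine Eventually.of_forall fun l => ae_of_all _ fun x _ => ?_
      have := hD0 l
      rw [Real.norm_eq_abs, abs_of_nonneg (by positivity), div_le_one (by positivity)]
      linarith [hT l x]
    · exact intervalIntegrable_const
    · refine ae_of_all _ fun x _ => ?_
      have h2 := ((h x).norm.pow 2)
      rw [norm_zero, zero_pow two_ne_zero] at h2
      refine squeeze_zero (fun l => ?_) (fun l => ?_) h2
      · have := hD0 l; positivity
      · exact div_le_self (by positivity) (by linarith [hD0 l])
  rw [intervalIntegral.integral_zero] at hlim
  have hI : ∀ᶠ l : ℕ in atTop, D l ≤ 1 := by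
    filter_upwards [hlim.eventually (gt_mem_nhds (half_pos Real.pi_pos)), eventually_ge_atTop 1] with l h1 h2
    rw [intervalIntegral.integral_div, integral_normSq_cexpI_pair _ _ (by omega),
      div_lt_iff₀ (by linarith [hD0 l])] at h1
    change 2 * Real.pi * D l < _ at h1
    nlinarith [Real.pi_pos, hD0 l]
  obtain ⟨M, hM⟩ := Filter.IsBoundedUnder.bddAbove_range ⟨1, eventually_map.2 hI⟩
  have hM' : ∀ l, D l ≤ M := fun l => hM ⟨l, rfl⟩
  refine ⟨M + 1, fun p => ?_⟩
  obtain ⟨l, rfl | rfl⟩ := p.eq_nat_or_neg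
  · nlinarith [hM' l, sq_nonneg ‖c (-l)‖, sq_nonneg (‖c l‖ - 1)]
  · nlinarith [hM' l, sq_nonneg ‖c l‖, sq_nonneg (‖c (-l)‖ - 1)]

/-- The uniqueness theorem of Cantor: a trigonometric series whose symmetric partial sums tend
to zero everywhere has zero coefficients. -/
theorem coeff_eq_zero_of_tendsto {c : ℤ → ℂ}
    (h : ∀ x : ℝ, Tendsto (fun L : ℕ => ∑ l ∈ Finset.range L,
      (c l * cexpI l x + c (-l) * cexpI (-l) x)) atTop (𝓝 (c 0))) (q : ℤ) : c q = 0 := by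
  obtain ⟨M, hM⟩ := norm_coeff_bounded_of_tendsto (c := c) fun x => by
    have := ((tendsto_add_atTop_iff_nat 1).2 (h x)).sub (h x)
    simpa [Finset.sum_range_succ] using this
  have hM0 : 0 ≤ M := (norm_nonneg _).trans (hM 0)
  have hsum : Summable fun p : ℤ => ‖c p / (p : ℂ) ^ 2‖ := by
    refine Summable.of_nonneg_of_le (fun _ => norm_nonneg _) (fun p => ?_)
      ((Real.summable_one_div_int_pow.2 one_lt_two).mul_left M)
    rw [norm_div, norm_pow, Complex.norm_intCast, sq_abs, mul_one_div]
    gcongr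
    exact hM p
  have hΦsum : ∀ x, HasSum (fun p : ℤ => c p / (p : ℂ) ^ 2 * cexpI p x)
      (∑' p : ℤ, c p / (p : ℂ) ^ 2 * cexpI p x) := fun x =>
    (Summable.of_norm (by simpa using hsum)).hasSum
  set Φ : ℝ → ℂ := fun x => ∑' p : ℤ, c p / (p : ℂ) ^ 2 * cexpI p x with hΦ
  have hΦc : Continuous Φ := continuous_tsum (fun p => continuous_const.mul (continuous_cexpI p))
    hsum (fun p x => by simp)
  have hΦper : ∀ x, Φ (x + 2 * Real.pi) = Φ x := fun x => by
    simp only [hΦ, cexpI_add_right, cexpI_two_pi, mul_one]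
  -- Riemann's function, the twice integrated series. The summand `p = 0` of `Φ` is `c 0 / 0 = 0`,
  -- and the quadratic term takes its place.
  set F : ℝ → ℂ := fun x => c 0 * (x : ℂ) ^ 2 / 2 - Φ x with hF
  have hFc : Continuous F := by fun_prop
  -- With step 2/K the second difference quotient multiplies -e^{ipx} / p² by p² sinc²(p/K), so that
  -- of `F` is the Riemann mean of the original series.
  set hh : ℕ → ℝ := fun K => 2 / (K : ℝ) with hhdef
  have hh0 : Tendsto hh atTop (𝓝 0) := tendsto_const_div_atTop_nhds_zero_nat 2
  have hhpos : ∀ᶠ K in atTop, 0 < hh K := by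
    filter_upwards [eventually_gt_atTop 0] with K hK
    have : (0 : ℝ) < K := by exact_mod_cast hK
    simp only [hhdef]; positivity
  have hdiff : ∀ x, Tendsto (fun K => (F (x + hh K) + F (x - hh K) - 2 * F x)
      / ((hh K : ℝ) : ℂ) ^ 2) atTop (𝓝 0) := by
    intro x
    -- The term `l = 0` in `h` counts `c 0` twice, which is why the limit there is `c 0`; one copy
    -- is removed here, and the partial sums of `B` tend to 0.
    refine tendsto_tsum_mul_sinc_sq (B := fun l : ℕ =>
      (c l * cexpI l x + c (-l) * cexpI (-l) x) - if l = 0 then c 0 else 0) ?_ ?_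
    · have := (h x).sub (hasSum_ite_eq (0 : ℕ) (c 0)).tendsto_sum_nat
      simpa only [sub_self, Finset.sum_sub_distrib] using this
    · intro K hK
      have hK' : (0 : ℝ) < K := by exact_mod_cast hK
      have hKc : (K : ℂ) ≠ 0 := by exact_mod_cast hK.ne'
      have hhK : ((hh K : ℝ) : ℂ) ≠ 0 := by
        simp only [hhdef]; exact_mod_cast (by positivity : (2 / (K : ℝ)) ≠ 0)
      have hs := ((((hΦsum (x + hh K)).add (hΦsum (x - hh K))).sub
        ((hΦsum x).mul_left 2)).neg.div_const (((hh K : ℝ) : ℂ) ^ 2)).add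
        (hasSum_ite_eq (0 : ℤ) (c 0))
      have e1 : -(Φ (x + hh K) + Φ (x - hh K) - 2 * Φ x) / ((hh K : ℝ) : ℂ) ^ 2 + c 0
          = (F (x + hh K) + F (x - hh K) - 2 * F x) / ((hh K : ℝ) : ℂ) ^ 2 := by
        simp only [hF]
        field_simp
        push_cast
        ring
      have e2 : ∀ p : ℤ, -(c p / (p : ℂ) ^ 2 * cexpI p (x + hh K)
          + c p / (p : ℂ) ^ 2 * cexpI p (x - hh K)
          - 2 * (c p / (p : ℂ) ^ 2 * cexpI p x)) / ((hh K : ℝ) : ℂ) ^ 2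
          + (if p = 0 then c 0 else 0)
          = c p * cexpI p x * ((Real.sinc (p / K) ^ 2 : ℝ) : ℂ) := by
        intro p
        rcases eq_or_ne p 0 with rfl | hp
        · simp
        have hp' : (p : ℂ) ≠ 0 := by exact_mod_cast hp
        have hpK : (p : ℝ) / K ≠ 0 := div_ne_zero (by exact_mod_cast hp) hK'.ne'
        have hcos : cexpI p (hh K) + cexpI p (-hh K) = 2 - 4 * (Real.sin (p / K) : ℂ) ^ 2 := by
          rw [cexpI_eq_cos_add_sin, cexpI_eq_cos_add_sin, mul_neg, Real.cos_neg, Real.sin_neg,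
            show (p : ℝ) * hh K = 2 * (p / K) by simp only [hhdef]; ring, Real.cos_two_mul]
          have := Real.sin_sq_add_cos_sq ((p : ℝ) / K)
          have h2 : ((Real.cos (p / K) : ℝ) : ℂ) ^ 2 = 1 - ((Real.sin (p / K) : ℝ) : ℂ) ^ 2 := by
            rw [← Complex.ofReal_pow, ← Complex.ofReal_pow, ← Complex.ofReal_one,
              ← Complex.ofReal_sub]
            congr 1; linarith
          push_cast at h2 ⊢
          linear_combination 4 * h2
        rw [if_neg hp, add_zero, sub_eq_add_neg x, cexpI_add_right, cexpI_add_right,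
          Real.sinc_of_ne_zero hpK]
        have e3 : -(c p / (p : ℂ) ^ 2 * (cexpI p x * cexpI p (hh K))
            + c p / (p : ℂ) ^ 2 * (cexpI p x * cexpI p (-hh K))
            - 2 * (c p / (p : ℂ) ^ 2 * cexpI p x))
            = -(c p / (p : ℂ) ^ 2 * cexpI p x * (cexpI p (hh K) + cexpI p (-hh K) - 2)) := by ring
        rw [e3, hcos]
        simp only [hhdef]
        push_cast
        field_simp
        ring
      simp only [e2] at hs
      have e1' := e1
      simp only [hΦ] at e1'
      rw [e1'] at hs
      have hs2 := hs.nat_add_neg.sub (hasSum_ite_eq (0 : ℕ) (c 0))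
      have hval : (F (x + hh K) + F (x - hh K) - 2 * F x) / ((hh K : ℝ) : ℂ) ^ 2
          + c 0 * cexpI 0 x * ((Real.sinc (((0 : ℤ) : ℝ) / K) ^ 2 : ℝ) : ℂ) - c 0
          = (F (x + hh K) + F (x - hh K) - 2 * F x) / ((hh K : ℝ) : ℂ) ^ 2 := by simp
      rw [hval] at hs2
      refine hs2.congr_fun fun l => ?_
      rcases Nat.eq_zero_or_pos l with rfl | hl
      · simp
      · have e4 : ((-(l : ℤ) : ℤ) : ℝ) / K = -((l : ℝ) / K) := by push_cast; ring
        rw [if_neg hl.ne', e4, Real.sinc_neg, Int.cast_natCast]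
        ring
  have haff : ∀ a b x : ℝ, a < b → x ∈ Set.Icc a b →
      F x = F a + (F b - F a) / ((b - a : ℝ) : ℂ) * ((x - a : ℝ) : ℂ) := fun a b x hab hx =>
    affine_of_second_difference_zero_complex hFc hhpos hh0 hdiff hab hx
  have hpi := Real.pi_pos
  have hpic : (Real.pi : ℂ) ≠ 0 := by exact_mod_cast hpi.ne'
  have hc0 : c 0 = 0 := by
    -- `Φ` takes the same value at -2π, 0 and 2π, so affinity of `F` at the midpoint leaves only the
    -- quadratic term.
    have h1 := haff (-(2 * Real.pi)) (2 * Real.pi) 0 (by linarith) ⟨by linarith, by linarith⟩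
    have p1 := hΦper 0
    have p2 := hΦper (-(2 * Real.pi))
    rw [zero_add] at p1
    rw [neg_add_cancel] at p2
    simp only [hF, p1, ← p2] at h1
    push_cast at h1
    field_simp at h1
    ring_nf at h1
    have h3 : c 0 * (Real.pi : ℂ) ^ 3 = 0 := by linear_combination (-1 / 8 : ℂ) * h1
    rcases mul_eq_zero.1 h3 with h | h
    · exact h
    · exact absurd h (pow_ne_zero 3 hpic)
  rcases eq_or_ne q 0 with rfl | hq
  · exact hc0
  have hconst : ∀ x ∈ Set.Icc 0 (2 * Real.pi), Φ x = Φ 0 := by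
    intro x hx
    have h1 := haff 0 (2 * Real.pi) x (by linarith) hx
    have p1 := hΦper 0
    rw [zero_add] at p1
    simp only [hF, p1, hc0] at h1
    simpa using h1
  have := coeff_eq_zero_of_hasSum_const (d := fun p : ℤ => c p / (p : ℂ) ^ 2) hsum
    (C := Φ 0) (fun x hx => by rw [← hconst x hx]; exact hΦsum x) hq
  have hq' : (q : ℂ) ≠ 0 := by exact_mod_cast hq
  rcases div_eq_zero_iff.1 this with h | h
  · exact h
  · exact absurd h (pow_ne_zero 2 hq')

/-! ### The Hermite–Padé denominator -/

/-- The rising factorial `(γ)_l`. -/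
noncomputable def risingFact (γ : ℝ) (l : ℕ) : ℝ := (ascPochhammer ℝ l).eval γ

theorem risingFact_succ (γ : ℝ) (l : ℕ) : risingFact γ (l + 1) = risingFact γ l * (γ + l) := by
  simp [risingFact, ascPochhammer_succ_right]

theorem risingFact_ne_zero {γ : ℝ} (hγ : ∀ p : ℕ, γ ≠ -(p : ℝ)) (l : ℕ) : risingFact γ l ≠ 0 := by
  induction l with
  | zero => simp [risingFact]
  | succ l ih =>
    rw [risingFact_succ]
    exact mul_ne_zero ih fun h => hγ l (by linarith)

theorem risingFact_add (γ : ℝ) (a r : ℕ) :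
    risingFact γ (a + r) = risingFact γ a * ∏ i ∈ Finset.range r, (γ + (a + r : ℕ) - 1 - i) := by
  induction r generalizing a with
  | zero => simp
  | succ r ih =>
    have h := ih (a + 1)
    rw [show a + 1 + r = a + (r + 1) by ring] at h
    rw [h, risingFact_succ, Finset.prod_range_succ]
    push_cast
    ring

theorem mlCoeff_eq (γ μ : ℝ) (l : ℕ) : mlCoeff γ μ l = μ ^ l / risingFact γ l := rfl

/-- The sum `∑ v_p ∏_{i < r} (c_i + p) z ^ p`, the value at `z` of the result of applying the
Euler operators `X d/dX + c_i` to `v`. -/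
noncomputable def eulerSum (c : ℕ → ℂ) (r M : ℕ) (v : ℂ[X]) (z : ℂ) : ℂ :=
  ∑ p ∈ Finset.range (M + 1), (∏ i ∈ Finset.range r, (c i + p)) * v.coeff p * z ^ p

theorem coeff_X_mul_derivative_add (c : ℂ) (v : ℂ[X]) (p : ℕ) :
    (X * derivative v + C c * v).coeff p = (c + p) * v.coeff p := by
  rw [coeff_add, coeff_C_mul]
  cases p with
  | zero => simp
  | succ p => rw [coeff_X_mul, coeff_derivative]; push_cast; ring

theorem eulerSum_zero (c : ℕ → ℂ) {M : ℕ} {v : ℂ[X]} (hv : v.natDegree ≤ M) (z : ℂ) :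
    eulerSum c 0 M v z = v.eval z := by
  rw [eval_eq_sum_range' (Nat.lt_succ_of_le hv), eulerSum]
  simp

theorem eulerSum_succ (c : ℕ → ℂ) (r M : ℕ) (v : ℂ[X]) (z : ℂ) :
    eulerSum c (r + 1) M v z
      = eulerSum (fun i => c (i + 1)) r M (X * derivative v + C (c 0) * v) z := by
  refine Finset.sum_congr rfl fun p _ => ?_
  rw [coeff_X_mul_derivative_add, Finset.prod_range_succ']
  ring

/-- At a zero `z ≠ 0` the operator X d/dX + c lowers the order of vanishing by exactly one, whatever
c is: X is invertible at `z` and c v vanishes to higher order. -/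
theorem X_sub_C_pow_succ_dvd_iff {z : ℂ} (hz : z ≠ 0) (c : ℂ) (v : ℂ[X]) (k : ℕ) :
    (X - C z) ^ (k + 1) ∣ v ↔ v.eval z = 0 ∧ (X - C z) ^ k ∣ X * derivative v + C c * v := by
  constructor
  · rintro ⟨w, rfl⟩
    refine ⟨by simp, ⟨(k + 1 : ℂ[X]) * X * w + (X - C z) * (X * derivative w + C c * w), ?_⟩⟩
    rw [derivative_mul, derivative_X_sub_C_pow]
    push_cast
    simp only [map_add, map_natCast, map_one]
    ring
  · rintro ⟨h0, hk⟩
    have step : ∀ j ≤ k, (X - C z) ^ (j + 1) ∣ v := by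
      intro j
      induction j with
      | zero => intro _; simpa using dvd_iff_isRoot.2 h0
      | succ j ih =>
        intro hj
        obtain ⟨w, rfl⟩ := ih (by omega)
        have h1 := (pow_dvd_pow (X - C z) hj).trans hk
        have e : X * derivative ((X - C z) ^ (j + 1) * w) + C c * ((X - C z) ^ (j + 1) * w)
            = (X - C z) ^ j * ((j + 1 : ℂ[X]) * X * w
              + (X - C z) * (X * derivative w + C c * w)) := by
          rw [derivative_mul, derivative_X_sub_C_pow]
          push_cast
          simp only [map_add, map_natCast, map_one]
          ring
        rw [e, pow_succ] at h1
        have h2 := (mul_dvd_mul_iff_left (pow_ne_zero j (X_sub_C_ne_zero z))).1 h1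
        rw [dvd_add_left (dvd_mul_right _ _), dvd_iff_isRoot] at h2
        have h3 : w.eval z = 0 := by
          have : ((j : ℂ) + 1) * z * w.eval z = 0 := by simpa [IsRoot] using h2
          rcases mul_eq_zero.1 this with h | h
          · exact absurd h (mul_ne_zero (by exact_mod_cast j.succ_ne_zero) hz)
          · exact h
        rw [pow_succ]
        exact mul_dvd_mul_left _ (dvd_iff_isRoot.2 h3)
    exact step k le_rfl

/-- The multiplicity criterion with Euler operators in place of derivatives, obtained by peeling off
one operator at a time. -/
theorem X_sub_C_pow_dvd_iff_eulerSum {z : ℂ} (hz : z ≠ 0) {M : ℕ} (k : ℕ) (c : ℕ → ℂ) (v : ℂ[X])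
    (hv : v.natDegree ≤ M) :
    (X - C z) ^ k ∣ v ↔ ∀ r < k, eulerSum c r M v z = 0 := by
  induction k generalizing c v with
  | zero => simp
  | succ k ih =>
    have hd : (X * derivative v + C (c 0) * v).natDegree ≤ M := by
      rw [natDegree_le_iff_coeff_eq_zero]
      intro p hp
      rw [coeff_X_mul_derivative_add, coeff_eq_zero_of_natDegree_lt (hv.trans_lt hp), mul_zero]
    rw [X_sub_C_pow_succ_dvd_iff hz (c 0), ih (fun i => c (i + 1)) _ hd, ← eulerSum_zero c hv]
    constructor
    · rintro ⟨h0, h1⟩ r hr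
      cases r with
      | zero => exact h0
      | succ r => rw [eulerSum_succ]; exact h1 r (by omega)
    · intro h
      refine ⟨h 0 (by omega), fun r hr => ?_⟩
      rw [← eulerSum_succ]
      exact h (r + 1) (by omega)

theorem coeff_coe_mul_eq_sum {Q : ℂ[X]} {M : ℕ} (hQ : Q.natDegree ≤ M) (f : PowerSeries ℂ)
    (a : ℕ) : PowerSeries.coeff (a + M) ((Q : PowerSeries ℂ) * f)
      = ∑ p ∈ Finset.range (M + 1), Q.coeff (M - p) * PowerSeries.coeff (a + p) f := by
  rw [PowerSeries.coeff_mul, Finset.Nat.sum_antidiagonal_eq_sum_range_succ_mk]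
  simp only [Polynomial.coeff_coe]
  have hsub : Finset.range (M + 1) ⊆ Finset.range (a + M).succ := by
    intro p; simp only [Finset.mem_range]; omega
  rw [← Finset.sum_subset hsub, ← Finset.sum_range_reflect]
  · refine Finset.sum_congr rfl fun p hp => ?_
    have := Finset.mem_range.1 hp
    rw [show M + 1 - 1 - p = M - p by omega, show a + M - (M - p) = a + p by omega]
  · intro p _ hp
    rw [coeff_eq_zero_of_natDegree_lt (by simp only [Finset.mem_range] at hp; omega), zero_mul]

theorem coeff_systemE {k : ℕ} (γ : ℝ) (lam : Fin k → ℝ) (j : Fin k) (l : ℕ) :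
    PowerSeries.coeff l (systemE γ lam j) = (lam j : ℂ) ^ l / (risingFact γ l : ℂ) := by
  rw [systemE, PowerSeries.coeff_mk, mlCoeff_eq]
  push_cast
  rfl

/-- The polynomial whose Laplace transform, in the sense of the Gamma integral, has the
reversed coefficients of `Q`. -/
noncomputable def borelPoly (γ : ℝ) (n M : ℕ) (Q : ℂ[X]) : ℂ[X] :=
  ∑ p ∈ Finset.range (M + 1),
    monomial p (Q.coeff (M - p) * (risingFact γ (n + M) / risingFact γ (n + p) : ℂ))

theorem coeff_borelPoly (γ : ℝ) (n M : ℕ) (Q : ℂ[X]) (p : ℕ) :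
    (borelPoly γ n M Q).coeff p = if p ≤ M then
      Q.coeff (M - p) * (risingFact γ (n + M) / risingFact γ (n + p) : ℂ) else 0 := by
  rw [borelPoly, finsetSum_coeff]
  simp only [coeff_monomial, Finset.sum_ite_eq', Finset.mem_range, Nat.lt_succ_iff]

theorem natDegree_borelPoly_le (γ : ℝ) (n M : ℕ) (Q : ℂ[X]) :
    (borelPoly γ n M Q).natDegree ≤ M := by
  rw [natDegree_le_iff_coeff_eq_zero]
  intro p hp
  rw [coeff_borelPoly, if_neg (by omega)]

/-- With n = a + r, the identity 1/(γ)_{a+p} = ∏_{i<r} (γ + n - 1 - i + p) / (γ)_{n+p} makes every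
coefficient a value of Euler operators on one polynomial that depends on n only. The product is the
factor produced by differentiating t^{n+γ-1+p} r times. -/
theorem coeff_coe_mul_systemE {k : ℕ} {γ : ℝ} (hγ : ∀ p : ℕ, γ ≠ -(p : ℝ)) (lam : Fin k → ℝ)
    (j : Fin k) {Q : ℂ[X]} {M : ℕ} (hQ : Q.natDegree ≤ M) (a r : ℕ) :
    PowerSeries.coeff (a + M) ((Q : PowerSeries ℂ) * systemE γ lam j)
      = (lam j : ℂ) ^ a / risingFact γ (a + r + M)
        * eulerSum (fun i => γ + (a + r : ℕ) - 1 - i) r M (borelPoly γ (a + r) M Q) (lam j) := by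
  rw [coeff_coe_mul_eq_sum hQ, eulerSum, Finset.mul_sum]
  refine Finset.sum_congr rfl fun p hp => ?_
  have hp' : p ≤ M := Nat.lt_succ_iff.1 (Finset.mem_range.1 hp)
  have hw : ∀ l, (risingFact γ l : ℂ) ≠ 0 := fun l => by exact_mod_cast risingFact_ne_zero hγ l
  rw [coeff_systemE, coeff_borelPoly, if_pos hp']
  have h := risingFact_add γ (a + p) r
  have h2 : (∏ i ∈ Finset.range r, ((γ : ℂ) + (a + r : ℕ) - 1 - i + p))
      = (risingFact γ (a + r + p) : ℂ) / risingFact γ (a + p) := by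
    rw [eq_div_iff (hw _), show a + r + p = a + p + r by ring, h]
    push_cast
    rw [mul_comm]
    congr 1
    refine Finset.prod_congr rfl fun i _ => ?_
    ring
  rw [h2]
  have := hw (a + p)
  have := hw (a + r + p)
  have := hw (a + r + M)
  field_simp
  ring

/-- The polynomial `∏ (X - λ_p) ^ {m_p}`. -/
noncomputable def nodePoly {k : ℕ} (lam : Fin k → ℝ) (m : Fin k → ℕ) : ℝ[X] :=
  ∏ p, (X - C (lam p)) ^ m p

theorem monic_nodePoly {k : ℕ} (lam : Fin k → ℝ) (m : Fin k → ℕ) : (nodePoly lam m).Monic :=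
  monic_prod_of_monic _ _ fun p _ => (monic_X_sub_C (lam p)).pow (m p)

theorem natDegree_nodePoly {k : ℕ} (lam : Fin k → ℝ) (m : Fin k → ℕ) :
    (nodePoly lam m).natDegree = ∑ i, m i := by
  rw [nodePoly, natDegree_prod_of_monic _ _ fun p _ => (monic_X_sub_C (lam p)).pow (m p)]
  simp

theorem map_nodePoly {k : ℕ} (lam : Fin k → ℝ) (m : Fin k → ℕ) :
    (nodePoly lam m).map (algebraMap ℝ ℂ) = ∏ p, (X - C (lam p : ℂ)) ^ m p := by
  simp [nodePoly, Polynomial.map_prod]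

/-- The Hermite–Padé denominator of the system `E_{k,γ}`, with value `1` at zero. -/
noncomputable def hermitePadeDen {k : ℕ} (γ : ℝ) (lam : Fin k → ℝ) (n : ℕ) (m : Fin k → ℕ) :
    ℂ[X] :=
  ∑ p ∈ Finset.range (∑ i, m i + 1), monomial p
    (((nodePoly lam m).coeff (∑ i, m i - p) * (risingFact γ (n + (∑ i, m i - p))
      / risingFact γ (n + ∑ i, m i)) : ℝ) : ℂ)

theorem coeff_hermitePadeDen {k : ℕ} (γ : ℝ) (lam : Fin k → ℝ) (n : ℕ) (m : Fin k → ℕ) (p : ℕ) :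
    (hermitePadeDen γ lam n m).coeff p = if p ≤ ∑ i, m i then
      (((nodePoly lam m).coeff (∑ i, m i - p) * (risingFact γ (n + (∑ i, m i - p))
      / risingFact γ (n + ∑ i, m i)) : ℝ) : ℂ) else 0 := by
  rw [hermitePadeDen, finsetSum_coeff]
  simp only [coeff_monomial, Finset.sum_ite_eq', Finset.mem_range, Nat.lt_succ_iff]

theorem natDegree_hermitePadeDen_le {k : ℕ} (γ : ℝ) (lam : Fin k → ℝ) (n : ℕ) (m : Fin k → ℕ) :
    (hermitePadeDen γ lam n m).natDegree ≤ ∑ i, m i := by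
  rw [natDegree_le_iff_coeff_eq_zero]
  intro p hp
  rw [coeff_hermitePadeDen, if_neg (by omega)]

section

variable {k : ℕ} {γ : ℝ} (hγ : ∀ p : ℕ, γ ≠ -(p : ℝ)) (lam : Fin k → ℝ) (n : ℕ) (m : Fin k → ℕ)

include hγ

theorem eval_zero_hermitePadeDen : (hermitePadeDen γ lam n m).eval 0 = 1 := by
  rw [← coeff_zero_eq_eval_zero, coeff_hermitePadeDen, if_pos (Nat.zero_le _), Nat.sub_zero]
  have h1 : (nodePoly lam m).coeff (∑ i, m i) = 1 := by
    rw [← natDegree_nodePoly lam m]; exact monic_nodePoly lam m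
  rw [h1, one_mul, div_self (risingFact_ne_zero hγ _), Complex.ofReal_one]

theorem borelPoly_hermitePadeDen :
    borelPoly γ n (∑ i, m i) (hermitePadeDen γ lam n m)
      = (nodePoly lam m).map (algebraMap ℝ ℂ) := by
  ext p
  rw [coeff_borelPoly, coeff_hermitePadeDen, coeff_map]
  have hw : ∀ l, (risingFact γ l : ℂ) ≠ 0 := fun l => by exact_mod_cast risingFact_ne_zero hγ l
  split_ifs with h1 h2
  · rw [show ∑ i, m i - (∑ i, m i - p) = p by omega]
    have := hw (n + p)
    have := hw (n + ∑ i, m i)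
    push_cast
    rw [Complex.coe_algebraMap]
    field_simp
  · omega
  · rw [coeff_eq_zero_of_natDegree_lt (by rw [natDegree_nodePoly]; omega), map_zero]

theorem eq_C_mul_of_borelPoly_eq {Q : ℂ[X]} (hQ : Q.natDegree ≤ ∑ i, m i) {c : ℂ}
    (h : borelPoly γ n (∑ i, m i) Q = C c * (nodePoly lam m).map (algebraMap ℝ ℂ)) :
    Q = C c * hermitePadeDen γ lam n m := by
  rw [← borelPoly_hermitePadeDen hγ lam n m] at h
  ext p
  rcases le_or_gt p (∑ i, m i) with hp | hp
  · have h1 := congrArg (fun v => v.coeff (∑ i, m i - p)) h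
    simp only [coeff_C_mul] at h1
    rw [coeff_borelPoly, coeff_borelPoly, if_pos (Nat.sub_le _ _),
      if_pos (Nat.sub_le _ _), ← mul_assoc,
      show ∑ i, m i - (∑ i, m i - p) = p by omega] at h1
    have hw : ∀ l, (risingFact γ l : ℂ) ≠ 0 := fun l => by exact_mod_cast risingFact_ne_zero hγ l
    rw [coeff_C_mul]
    exact mul_right_cancel₀ (div_ne_zero (hw _) (hw _)) h1
  · rw [coeff_C_mul, coeff_eq_zero_of_natDegree_lt (hQ.trans_lt hp),
      coeff_eq_zero_of_natDegree_lt ((natDegree_hermitePadeDen_le γ lam n m).trans_lt hp), mul_zero]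

/-- The coefficient of index l = n + M - r corresponds to the r-th Euler condition, 0 ≤ r < `m j`.
The hypothesis `m j ≤ n` keeps the exponent n - r of `lam j` from being truncated. -/
theorem X_sub_C_pow_dvd_borelPoly_iff (hlam0 : ∀ j, lam j ≠ 0) (hm : ∀ j, m j ≤ n)
    {Q : ℂ[X]} (hQ : Q.natDegree ≤ ∑ i, m i) (j : Fin k) :
    (X - C (lam j : ℂ)) ^ m j ∣ borelPoly γ n (∑ i, m i) Q ↔
      ∀ l, n + ∑ i, m i - m j < l → l ≤ n + ∑ i, m i →
        PowerSeries.coeff l ((Q : PowerSeries ℂ) * systemE γ lam j) = 0 := by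
  have hz : (lam j : ℂ) ≠ 0 := by exact_mod_cast hlam0 j
  have hw : ∀ l, (risingFact γ l : ℂ) ≠ 0 := fun l => by exact_mod_cast risingFact_ne_zero hγ l
  have hmj := hm j
  have hmM : m j ≤ ∑ i, m i := Finset.single_le_sum (f := m) (fun _ _ => Nat.zero_le _)
    (Finset.mem_univ j)
  rw [X_sub_C_pow_dvd_iff_eulerSum hz (m j) (fun i => γ + (n : ℕ) - 1 - i) _
    (natDegree_borelPoly_le _ _ _ _)]
  have key : ∀ r ≤ n, (PowerSeries.coeff (n - r + ∑ i, m i)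
      ((Q : PowerSeries ℂ) * systemE γ lam j) = 0 ↔
      eulerSum (fun i => γ + (n : ℕ) - 1 - i) r (∑ i, m i) (borelPoly γ n (∑ i, m i) Q)
        (lam j) = 0) := by
    intro r hr
    have h := coeff_coe_mul_systemE hγ lam j hQ (n - r) r
    rw [Nat.sub_add_cancel hr] at h
    rw [h, mul_eq_zero, or_iff_right (div_ne_zero (pow_ne_zero _ hz) (hw _))]
  constructor
  · intro h l hl1 hl2
    have := (key (n + ∑ i, m i - l) (by omega)).2 (h _ (by omega))
    rwa [show n - (n + ∑ i, m i - l) + ∑ i, m i = l by omega] at this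
  · intro h r hr
    exact (key r (by omega)).1 (h _ (by omega) (by omega))

/-- `hermitePadeDen` is a denominator: the truncations of the products are numerators. -/
theorem exists_isHermitePade (hlam0 : ∀ j, lam j ≠ 0) (hm : ∀ j, m j ≤ n) :
    ∃ P, IsHermitePade (systemE γ lam) n m (hermitePadeDen γ lam n m) P := by
  refine ⟨fun j => PowerSeries.trunc (n + ∑ i, m i - m j + 1)
    ((hermitePadeDen γ lam n m : PowerSeries ℂ) * systemE γ lam j), ?_,
    natDegree_hermitePadeDen_le _ _ _ _, fun j => ⟨?_, fun l hl => ?_⟩⟩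
  · intro h
    have := eval_zero_hermitePadeDen hγ lam n m
    rw [h, eval_zero] at this
    exact zero_ne_one this
  · exact Nat.lt_succ_iff.1 (PowerSeries.natDegree_trunc_lt _ _)
  · rw [map_sub, Polynomial.coeff_coe, PowerSeries.coeff_trunc]
    split_ifs with h
    · exact sub_self _
    · rw [sub_zero]
      refine (X_sub_C_pow_dvd_borelPoly_iff hγ lam n m hlam0 hm
        (natDegree_hermitePadeDen_le _ _ _ _) j).1 ?_ l (by omega) hl
      rw [borelPoly_hermitePadeDen hγ, map_nodePoly]
      exact Finset.dvd_prod_of_mem _ (Finset.mem_univ j)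

/-- Powers at distinct nodes are coprime, so their product divides `borelPoly`; its degree is
already the largest allowed, and only a constant factor remains. -/
theorem IsHermitePade.eq_C_mul (hlam : Function.Injective lam) (hlam0 : ∀ j, lam j ≠ 0)
    (hm : ∀ j, m j ≤ n) {Q : ℂ[X]} {P : Fin k → ℂ[X]}
    (h : IsHermitePade (systemE γ lam) n m Q P) :
    ∃ c : ℂ, Q = C c * hermitePadeDen γ lam n m := by
  obtain ⟨-, hQ, hP⟩ := h
  have hdvd : (nodePoly lam m).map (algebraMap ℝ ℂ) ∣ borelPoly γ n (∑ i, m i) Q := by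
    rw [map_nodePoly]
    refine Finset.prod_dvd_of_coprime ?_ fun j _ => ?_
    · intro i _ j _ hij
      refine IsCoprime.pow (isCoprime_X_sub_C_of_isUnit_sub ?_)
      rw [isUnit_iff_ne_zero, sub_ne_zero]
      exact fun h => hij (hlam (by exact_mod_cast h))
    · rw [X_sub_C_pow_dvd_borelPoly_iff hγ lam n m hlam0 hm hQ]
      intro l hl1 hl2
      have := (hP j).2 l hl2
      rwa [map_sub, Polynomial.coeff_coe,
        coeff_eq_zero_of_natDegree_lt ((hP j).1.trans_lt hl1), sub_zero] at this
  have hmonic := (monic_nodePoly lam m).map (algebraMap ℝ ℂ)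
  obtain ⟨c, hc⟩ : ∃ c : ℂ, borelPoly γ n (∑ i, m i) Q
      = C c * (nodePoly lam m).map (algebraMap ℝ ℂ) := by
    refine ⟨_, eq_leadingCoeff_mul_of_monic_of_dvd_of_natDegree_le hmonic hdvd ?_⟩
    rw [(monic_nodePoly lam m).natDegree_map, natDegree_nodePoly]
    exact natDegree_borelPoly_le _ _ _ _
  exact ⟨c, eq_C_mul_of_borelPoly_eq hγ lam n m hQ hc⟩

/-- The leading coefficient of the remainders. -/
theorem coeff_hermitePadeDen_mul_systemE_succ (j : Fin k) :
    PowerSeries.coeff (n + ∑ i, m i + 1)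
        ((hermitePadeDen γ lam n m : PowerSeries ℂ) * systemE γ lam j)
      = ((lam j ^ (n + 1) / risingFact γ (n + ∑ i, m i) *
        ∑ p ∈ Finset.range (∑ i, m i + 1),
          (nodePoly lam m).coeff p / (γ + n + p) * lam j ^ p : ℝ) : ℂ) := by
  rw [show n + ∑ i, m i + 1 = n + 1 + ∑ i, m i by ring,
    coeff_coe_mul_eq_sum (natDegree_hermitePadeDen_le _ _ _ _), Finset.mul_sum, Complex.ofReal_sum]
  refine Finset.sum_congr rfl fun p hp => ?_
  have hp' : p ≤ ∑ i, m i := Nat.lt_succ_iff.1 (Finset.mem_range.1 hp)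
  rw [coeff_hermitePadeDen, if_pos (Nat.sub_le _ _), coeff_systemE,
    show ∑ i, m i - (∑ i, m i - p) = p by omega, ← Complex.ofReal_pow, ← Complex.ofReal_div,
    ← Complex.ofReal_mul]
  congr 1
  have h1 := risingFact_ne_zero hγ (n + p)
  have h2 := risingFact_ne_zero hγ (n + ∑ i, m i)
  have h3 : γ + n + p ≠ 0 := fun h => hγ (n + p) (by push_cast; linarith)
  rw [show n + 1 + p = n + p + 1 by ring, risingFact_succ]
  push_cast
  rw [show γ + ((n : ℝ) + p) = γ + n + p by ring]
  field_simp
  ring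

end

/-! ### The denominator has no zeros in the closed unit disc -/

theorem coeff_zero_prod_one_sub (s : Multiset ℝ) :
    (s.map fun x => 1 - C x * X).prod.coeff 0 = 1 := by
  rw [coeff_zero_eq_eval_zero, eval_multiset_prod]
  simp

theorem coeff_succ_prod_one_sub_cons (x : ℝ) (s : Multiset ℝ) (p : ℕ) :
    ((x ::ₘ s).map fun x => 1 - C x * X).prod.coeff (p + 1)
      = (s.map fun x => 1 - C x * X).prod.coeff (p + 1)
        - x * (s.map fun x => 1 - C x * X).prod.coeff p := by
  rw [Multiset.map_cons, Multiset.prod_cons, sub_mul, one_mul, coeff_sub, mul_assoc, coeff_C_mul,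
    coeff_X_mul]

theorem abs_coeff_prod_one_sub_le {Λ : ℝ} (s : Multiset ℝ) (hs : ∀ x ∈ s, |x| ≤ Λ) (p : ℕ) :
    |(s.map fun x => 1 - C x * X).prod.coeff p| ≤ (s.card.choose p) * Λ ^ p := by
  induction s using Multiset.induction generalizing p with
  | empty => cases p <;> simp [coeff_one]
  | cons x s ih =>
    have hx := hs x (Multiset.mem_cons_self x s)
    have ih' := ih fun y hy => hs y (Multiset.mem_cons_of_mem hy)
    cases p with
    | zero => rw [coeff_zero_prod_one_sub]; simp
    | succ p =>
      rw [coeff_succ_prod_one_sub_cons, Multiset.card_cons, Nat.choose_succ_succ]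
      calc _ ≤ _ := abs_sub _ _
        _ ≤ (s.card.choose (p + 1)) * Λ ^ (p + 1) + Λ * ((s.card.choose p) * Λ ^ p) := by
          rw [abs_mul]
          exact add_le_add (ih' _) (mul_le_mul hx (ih' _) (abs_nonneg _) ((abs_nonneg _).trans hx))
        _ = _ := by push_cast; ring

/-- The coefficients of `∏ (1 - x X)` almost satisfy the recurrence of those of
`exp (-(∑ x) X)`. -/
theorem abs_coeff_recurrence_le {Λ : ℝ} (s : Multiset ℝ) (hs : ∀ x ∈ s, |x| ≤ Λ) (p : ℕ) :
    |(p + 1) * (s.map fun x => 1 - C x * X).prod.coeff (p + 1)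
      + s.sum * (s.map fun x => 1 - C x * X).prod.coeff p|
      ≤ p * (s.card.choose p) * Λ ^ (p + 1) := by
  induction s using Multiset.induction generalizing p with
  | empty => cases p <;> simp [coeff_one]
  | cons x s ih =>
    have hx := hs x (Multiset.mem_cons_self x s)
    have hΛ : 0 ≤ Λ := (abs_nonneg _).trans hx
    have hs' : ∀ y ∈ s, |y| ≤ Λ := fun y hy => hs y (Multiset.mem_cons_of_mem hy)
    have ih' := ih hs'
    cases p with
    | zero =>
      have := ih' 0
      simp only [Nat.cast_zero, zero_add, one_mul, zero_mul, coeff_zero_prod_one_sub, mul_one]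
        at this ⊢
      rw [coeff_succ_prod_one_sub_cons x s 0, Multiset.sum_cons, coeff_zero_prod_one_sub]
      convert this using 2
      ring
    | succ p =>
      rw [coeff_succ_prod_one_sub_cons, coeff_succ_prod_one_sub_cons, Multiset.card_cons,
        Multiset.sum_cons, Nat.choose_succ_succ]
      set f : ℕ → ℝ := fun q => (s.map fun x => 1 - C x * X).prod.coeff q with hf
      have h1 := ih' (p + 1)
      have h2 := ih' p
      have h3 := abs_coeff_prod_one_sub_le s hs' p
      change |_ * f (p + 2) + _ * f (p + 1)| ≤ _ at h1
      change |_ * f (p + 1) + _ * f p| ≤ _ at h2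
      change |f p| ≤ _ at h3
      -- The defect for `x ::ₘ s` is made of two defects for `s` and the new error x² f_p; Pascal's
      -- rule adds up the three bounds exactly.
      have e : ((p + 1 : ℕ) + 1 : ℝ) * (f (p + 2) - x * f (p + 1))
          + (x + s.sum) * (f (p + 1) - x * f p)
          = (((p + 1 : ℕ) + 1 : ℝ) * f (p + 2) + s.sum * f (p + 1))
            - x * ((p + 1) * f (p + 1) + s.sum * f p) - x ^ 2 * f p := by push_cast; ring
      change |((p + 1 : ℕ) + 1 : ℝ) * (f (p + 2) - x * f (p + 1))
          + (x + s.sum) * (f (p + 1) - x * f p)| ≤ _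
      rw [e]
      have hx2 : |x ^ 2| ≤ Λ ^ 2 := by rw [abs_pow]; exact pow_le_pow_left₀ (abs_nonneg _) hx 2
      calc _ ≤ |((p + 1 : ℕ) + 1 : ℝ) * f (p + 2) + s.sum * f (p + 1)|
            + |x| * |(p + 1) * f (p + 1) + s.sum * f p| + |x ^ 2| * |f p| := by
            rw [← abs_mul, ← abs_mul]
            exact (abs_sub _ _).trans (add_le_add_left (abs_sub _ _) _)
        _ ≤ (p + 1 : ℕ) * (s.card.choose (p + 1)) * Λ ^ (p + 1 + 1)
            + Λ * (p * (s.card.choose p) * Λ ^ (p + 1)) + Λ ^ 2 * ((s.card.choose p) * Λ ^ p) := by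
            gcongr
        _ = _ := by push_cast; ring

theorem reverse_X_sub_C (x : ℝ) : (X - C x : ℝ[X]).reverse = 1 - C x * X := by
  rw [reverse, natDegree_X_sub_C, reflect_sub, reflect_C, pow_one,
    ← pow_one (X : ℝ[X]), reflect_monomial]
  simp

theorem reverse_prod_X_sub_C (s : Multiset ℝ) :
    (s.map fun x => X - C x).prod.reverse = (s.map fun x => 1 - C x * X).prod := by
  induction s using Multiset.induction with
  | empty => simpa using reverse_C (1 : ℝ)
  | cons x s ih =>
    rw [Multiset.map_cons, Multiset.prod_cons, reverse_mul_of_domain, ih, reverse_X_sub_C,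
      Multiset.map_cons, Multiset.prod_cons]

/-- The multiset of the `λ_j`, with multiplicities `m_j`. -/
def nodeMultiset {k : ℕ} (lam : Fin k → ℝ) (m : Fin k → ℕ) : Multiset ℝ :=
  ∑ j, Multiset.replicate (m j) (lam j)

theorem card_nodeMultiset {k : ℕ} (lam : Fin k → ℝ) (m : Fin k → ℕ) :
    (nodeMultiset lam m).card = ∑ j, m j := by
  simp [nodeMultiset]

theorem abs_le_of_mem_nodeMultiset {k : ℕ} {lam : Fin k → ℝ} {m : Fin k → ℕ} {Λ : ℝ}
    (hΛ : ∀ j, |lam j| ≤ Λ) {x : ℝ} (hx : x ∈ nodeMultiset lam m) : |x| ≤ Λ := by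
  obtain ⟨j, -, hj⟩ := Multiset.mem_sum.1 hx
  rw [Multiset.eq_of_mem_replicate hj]
  exact hΛ j

theorem nodePoly_eq_prod_map {k : ℕ} (lam : Fin k → ℝ) (m : Fin k → ℕ) :
    nodePoly lam m = ((nodeMultiset lam m).map fun x => X - C x).prod := by
  rw [nodeMultiset, nodePoly]
  induction (Finset.univ : Finset (Fin k)) using Finset.cons_induction with
  | empty => simp
  | cons a s ha ih =>
    rw [Finset.prod_cons, Finset.sum_cons, Multiset.map_add, Multiset.prod_add, ih]
    simp

theorem coeff_nodePoly_sub {k : ℕ} (lam : Fin k → ℝ) (m : Fin k → ℕ) {p : ℕ} (hp : p ≤ ∑ i, m i) :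
    (nodePoly lam m).coeff (∑ i, m i - p)
      = ((nodeMultiset lam m).map fun x => 1 - C x * X).prod.coeff p := by
  rw [← reverse_prod_X_sub_C, ← nodePoly_eq_prod_map, coeff_reverse, natDegree_nodePoly,
    revAt_le hp]

theorem abs_sum_le_card_mul {Λ : ℝ} (s : Multiset ℝ) (hs : ∀ x ∈ s, |x| ≤ Λ) :
    |s.sum| ≤ s.card * Λ := by
  induction s using Multiset.induction with
  | empty => simp
  | cons x s ih =>
    rw [Multiset.sum_cons, Multiset.card_cons]
    have h1 := hs x (Multiset.mem_cons_self x s)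
    have h2 := ih fun y hy => hs y (Multiset.mem_cons_of_mem hy)
    have := abs_add_le x s.sum
    push_cast
    linarith

theorem risingFact_div_succ (γ : ℝ) {n : ℕ} (hn : 1 ≤ n) {M p : ℕ} (hp : p ≤ M) :
    risingFact γ (n + M - p) / risingFact γ (n + M)
      = risingFact γ (n + M - (p + 1)) / risingFact γ (n + M) * (n + M + γ - 1 - p) := by
  rw [show n + M - p = n + M - (p + 1) + 1 by omega, risingFact_succ,
    Nat.cast_sub (by omega : p + 1 ≤ n + M)]
  push_cast
  ring

/-- The quotient is the reciprocal of a product of factors that are at least n + γ - 1, so it is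
positive even if the rising factorials are not. The range goes up to M + 1 because the derivative of
Q shifts the index by one. -/
theorem risingFact_div_pos {γ : ℝ} (hγ : ∀ p : ℕ, γ ≠ -(p : ℝ)) {n : ℕ} (hn : 1 ≤ n)
    (ha : 0 < n + γ - 1) {M p : ℕ} (hp : p ≤ M + 1) :
    0 < risingFact γ (n + M - p) / risingFact γ (n + M) := by
  induction p with
  | zero => rw [Nat.sub_zero, div_self (risingFact_ne_zero hγ _)]; exact one_pos
  | succ p ih =>
    have h := ih (by omega)
    have hpM : (p : ℝ) ≤ M := by exact_mod_cast (by omega : p ≤ M)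
    rw [risingFact_div_succ γ hn (by omega)] at h
    exact pos_of_mul_pos_left h (by linarith)

theorem descFactorial_mul_risingFact_div_le {γ : ℝ} (hγ : ∀ p : ℕ, γ ≠ -(p : ℝ)) {n : ℕ} (hn : 1 ≤ n)
    (ha : 0 < n + γ - 1) {M p : ℕ} (hp : p ≤ M) :
    M.descFactorial p * (risingFact γ (n + M - p) / risingFact γ (n + M)) ≤ 1 := by
  induction p with
  | zero => rw [Nat.sub_zero, div_self (risingFact_ne_zero hγ _)]; simp
  | succ p ih =>
    have h := ih (by omega)
    have hpos := risingFact_div_pos hγ hn ha (M := M) (p := p + 1) (by omega)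
    refine le_trans ?_ h
    have hpM : (p : ℝ) ≤ M := by exact_mod_cast (by omega : p ≤ M)
    rw [risingFact_div_succ γ hn (M := M) (p := p) (by omega), Nat.descFactorial_succ,
      Nat.cast_mul, Nat.cast_sub (by omega)]
    have : (M : ℝ) - p ≤ n + M + γ - 1 - p := by linarith
    calc _ = M.descFactorial p * (risingFact γ (n + M - (p + 1)) / risingFact γ (n + M)
          * ((M : ℝ) - p)) := by ring
      _ ≤ _ := by gcongr

/-- The p factors of the falling factorial of M are absorbed by p denominators; the one denominator
left over gives the gain 1/(n + γ - 1), uniform in M. -/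
theorem choose_mul_risingFact_div_le {γ : ℝ} (hγ : ∀ p : ℕ, γ ≠ -(p : ℝ)) {n : ℕ} (hn : 1 ≤ n)
    (ha : 0 < n + γ - 1) {M p : ℕ} (hp : p ≤ M) :
    M.choose p * (risingFact γ (n + M - (p + 1)) / risingFact γ (n + M))
      ≤ 1 / p.factorial / (n + γ - 1) := by
  have h := descFactorial_mul_risingFact_div_le hγ hn ha hp
  have hpos := risingFact_div_pos hγ hn ha (M := M) (p := p + 1) (by omega)
  rw [risingFact_div_succ γ hn hp, Nat.descFactorial_eq_factorial_mul_choose] at h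
  have hpM : (p : ℝ) ≤ M := by exact_mod_cast hp
  have hf : (0 : ℝ) < p.factorial := by exact_mod_cast p.factorial_pos
  rw [div_div, le_div_iff₀ (by positivity)]
  refine le_trans ?_ h
  push_cast
  have h1 : (n + γ - 1 : ℝ) ≤ n + M + γ - 1 - p := by linarith
  calc _ = p.factorial * M.choose p * (risingFact γ (n + M - (p + 1)) / risingFact γ (n + M)
        * (n + γ - 1)) := by ring
    _ ≤ _ := mul_le_mul_of_nonneg_left (mul_le_mul_of_nonneg_left h1 hpos.le) (by positivity)

/-- Valid for every `p`: beyond the degree the truncated index in the quotient is harmless, because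
the coefficient of the product is zero. -/
theorem coeff_hermitePadeDen_eq {k : ℕ} (γ : ℝ) (lam : Fin k → ℝ) (n : ℕ)
    (m : Fin k → ℕ) (p : ℕ) :
    (hermitePadeDen γ lam n m).coeff p
      = ((((nodeMultiset lam m).map fun x => 1 - C x * X).prod.coeff p
        * (risingFact γ (n + ∑ i, m i - p) / risingFact γ (n + ∑ i, m i)) : ℝ) : ℂ) := by
  rw [coeff_hermitePadeDen]
  split_ifs with hp
  · rw [coeff_nodePoly_sub lam m hp, Nat.add_sub_assoc hp]
  · have h0 : ((nodeMultiset lam m).map fun x => 1 - C x * X).prod.coeff p = 0 := by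
      rw [← reverse_prod_X_sub_C, ← nodePoly_eq_prod_map]
      refine coeff_eq_zero_of_natDegree_lt ?_
      have := reverse_natDegree_le (nodePoly lam m)
      rw [natDegree_nodePoly] at this
      omega
    rw [h0]; simp

/-- With s = σ/(n + M + γ) one has s (n + M + γ - 1 - p) = σ - s (p + 1). Hence, apart from the
weight of index p + 1, the coefficient is the defect of the exponential recurrence minus s (p + 1)
f_p. The two bounds add up to (2p + 1) C(M, p) Λ^{p+1}, and 2p + 1 ≤ 3^p. -/
theorem norm_coeff_derivative_add_le {k : ℕ} {γ : ℝ} (hγ : ∀ p : ℕ, γ ≠ -(p : ℝ))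
    (lam : Fin k → ℝ) {n : ℕ} (hn : 1 ≤ n) (m : Fin k → ℕ) (ha : 0 < n + γ - 1)
    {Λ : ℝ} (hΛ0 : 0 ≤ Λ) (hΛ : ∀ j, |lam j| ≤ Λ) (p : ℕ) :
    ‖(derivative (hermitePadeDen γ lam n m)
      + C (((nodeMultiset lam m).sum / (n + (∑ i, m i : ℕ) + γ) : ℝ) : ℂ)
        * hermitePadeDen γ lam n m).coeff p‖
      ≤ Λ * ((3 * Λ) ^ p / p.factorial) / (n + γ - 1) := by
  have hs : ∀ x ∈ nodeMultiset lam m, |x| ≤ Λ := fun x hx => abs_le_of_mem_nodeMultiset hΛ hx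
  rw [coeff_add, coeff_derivative, coeff_C_mul, coeff_hermitePadeDen_eq,
    coeff_hermitePadeDen_eq]
  have hT := abs_coeff_recurrence_le (nodeMultiset lam m) hs p
  have hf := abs_coeff_prod_one_sub_le (nodeMultiset lam m) hs p
  have hf1 := abs_coeff_prod_one_sub_le (nodeMultiset lam m) hs (p + 1)
  have hσ := abs_sum_le_card_mul (nodeMultiset lam m) hs
  rw [card_nodeMultiset] at hT hf hf1 hσ
  set M := ∑ i, m i
  set σ := (nodeMultiset lam m).sum
  set f : ℕ → ℝ := fun q => ((nodeMultiset lam m).map fun x => 1 - C x * X).prod.coeff q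
  change |(p + 1) * f (p + 1) + σ * f p| ≤ _ at hT
  change |f p| ≤ _ at hf
  change |f (p + 1)| ≤ _ at hf1
  change ‖((f (p + 1) * _ : ℝ) : ℂ) * ((p : ℂ) + 1) + _ * ((f p * _ : ℝ) : ℂ)‖ ≤ _
  rcases le_or_gt p M with hp | hp
  · have hpM : (p : ℝ) ≤ M := by exact_mod_cast hp
    have hN : 0 < n + (M : ℝ) + γ := by linarith [(Nat.cast_nonneg p : (0 : ℝ) ≤ p)]
    have hMN : (M : ℝ) ≤ n + M + γ := by linarith
    have hκ := risingFact_div_pos hγ hn ha (M := M) (p := p + 1) (by omega)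
    have hκ2 := choose_mul_risingFact_div_le hγ hn ha hp
    rw [risingFact_div_succ γ hn hp]
    set κ := risingFact γ (n + M - (p + 1)) / risingFact γ (n + M)
    have e : ((f (p + 1) * κ : ℝ) : ℂ) * ((p : ℂ) + 1)
        + ((σ / (n + (M : ℝ) + γ) : ℝ) : ℂ) * ((f p * (κ * (n + M + γ - 1 - p)) : ℝ) : ℂ)
        = ((κ * (((p + 1) * f (p + 1) + σ * f p)
          - σ / (n + (M : ℝ) + γ) * ((p + 1) * f p)) : ℝ) : ℂ) := by
      have : f (p + 1) * κ * ((p : ℝ) + 1) + σ / (n + (M : ℝ) + γ) * (f p * (κ * (n + M + γ - 1 - p)))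
        = κ * (((p + 1) * f (p + 1) + σ * f p) - σ / (n + (M : ℝ) + γ) * ((p + 1) * f p)) := by
        field_simp
        ring
      rw [← this]
      push_cast
      ring
    rw [e, Complex.norm_real, Real.norm_eq_abs, abs_mul, abs_of_pos hκ]
    have hσN : |σ / (n + (M : ℝ) + γ)| ≤ Λ := by
      rw [abs_div, abs_of_pos hN, div_le_iff₀ hN, mul_comm Λ]
      exact hσ.trans (by gcongr)
    have h3 : (2 * p + 1 : ℝ) ≤ 3 ^ p := by
      have := one_add_mul_le_pow (show (-2 : ℝ) ≤ 2 by norm_num) p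
      norm_num at this
      linarith
    calc κ * |((p + 1) * f (p + 1) + σ * f p) - σ / (n + (M : ℝ) + γ) * ((p + 1) * f p)|
        ≤ κ * (p * (M.choose p) * Λ ^ (p + 1) + Λ * ((p + 1) * ((M.choose p) * Λ ^ p))) := by
          gcongr
          refine (abs_sub _ _).trans (add_le_add hT ?_)
          rw [abs_mul, abs_mul, abs_of_nonneg (by positivity : (0 : ℝ) ≤ p + 1)]
          gcongr
      _ = (M.choose p * κ) * ((2 * p + 1) * Λ ^ (p + 1)) := by ring
      _ ≤ (1 / p.factorial / (n + γ - 1)) * (3 ^ p * Λ ^ (p + 1)) := by gcongr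
      _ = _ := by rw [mul_pow]; ring
  · rw [Nat.choose_eq_zero_of_lt hp] at hf
    rw [Nat.choose_eq_zero_of_lt (by omega)] at hf1
    have e0 : f p = 0 := abs_nonpos_iff.1 (by simpa using hf)
    have e1 : f (p + 1) = 0 := abs_nonpos_iff.1 (by simpa using hf1)
    rw [e0, e1]
    simp only [zero_mul, Complex.ofReal_zero, mul_zero, add_zero, norm_zero]
    positivity

theorem norm_eval_derivative_add_le {k : ℕ} {γ : ℝ} (hγ : ∀ p : ℕ, γ ≠ -(p : ℝ))
    (lam : Fin k → ℝ) {n : ℕ} (hn : 1 ≤ n) (m : Fin k → ℕ) (ha : 0 < n + γ - 1)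
    {Λ : ℝ} (hΛ0 : 0 ≤ Λ) (hΛ : ∀ j, |lam j| ≤ Λ) {z : ℂ}
    (hz : ‖z‖ ≤ 1) :
    ‖(derivative (hermitePadeDen γ lam n m)
      + C (((nodeMultiset lam m).sum / (n + (∑ i, m i : ℕ) + γ) : ℝ) : ℂ)
        * hermitePadeDen γ lam n m).eval z‖ ≤ Λ * Real.exp (3 * Λ) / (n + γ - 1) := by
  have h := norm_coeff_derivative_add_le hγ lam hn m ha hΛ0 hΛ
  set D := derivative (hermitePadeDen γ lam n m)
      + C (((nodeMultiset lam m).sum / (n + (∑ i, m i : ℕ) + γ) : ℝ) : ℂ)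
        * hermitePadeDen γ lam n m
  rw [eval_eq_sum_range]
  calc _ ≤ ∑ p ∈ Finset.range (D.natDegree + 1), ‖D.coeff p * z ^ p‖ := norm_sum_le _ _
    _ ≤ ∑ p ∈ Finset.range (D.natDegree + 1), Λ * ((3 * Λ) ^ p / p.factorial) / (n + γ - 1) := by
      refine Finset.sum_le_sum fun p _ => ?_
      rw [norm_mul, norm_pow]
      exact (mul_le_of_le_one_right (norm_nonneg _) (pow_le_one₀ (norm_nonneg _) hz)).trans (h p)
    _ = Λ * (∑ p ∈ Finset.range (D.natDegree + 1), (3 * Λ) ^ p / p.factorial) / (n + γ - 1) := by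
      rw [← Finset.sum_div, ← Finset.mul_sum]
    _ ≤ _ := by
      gcongr
      exact Real.sum_le_exp_of_nonneg (by positivity) _

/-- On the unit disc the derivative e^{sz} (Q' + sQ) of e^{sz} Q is at most e^Λ · Λ e^{3Λ} / (n + γ
- 1) < 1, so e^{sz} Q stays at distance less than 1 from its value 1 at zero. -/
theorem hermitePadeDen_eval_ne_zero {k : ℕ} {γ : ℝ} (hγ : ∀ p : ℕ, γ ≠ -(p : ℝ))
    (lam : Fin k → ℝ) {n : ℕ} (hn : 1 ≤ n) (m : Fin k → ℕ) {Λ : ℝ} (hΛ0 : 0 ≤ Λ)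
    (hΛ : ∀ j, |lam j| ≤ Λ) (ha : Λ * Real.exp (4 * Λ) < n + γ - 1) {z : ℂ} (hz : ‖z‖ ≤ 1) :
    (hermitePadeDen γ lam n m).eval z ≠ 0 := by
  intro h0
  have ha0 : 0 < n + γ - 1 := lt_of_le_of_lt (by positivity) ha
  set s : ℝ := (nodeMultiset lam m).sum / (n + (∑ i, m i : ℕ) + γ) with hs
  have hsΛ : |s| ≤ Λ := by
    have hσ := abs_sum_le_card_mul (nodeMultiset lam m)
      (fun x hx => abs_le_of_mem_nodeMultiset hΛ hx)
    rw [card_nodeMultiset] at hσ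
    have hM : (0 : ℝ) ≤ (∑ i, m i : ℕ) := Nat.cast_nonneg _
    have hN : 0 < n + ((∑ i, m i : ℕ) : ℝ) + γ := by linarith
    rw [hs, abs_div, abs_of_pos hN, div_le_iff₀ hN, mul_comm Λ]
    refine hσ.trans ?_
    gcongr
    linarith
  set Q := hermitePadeDen γ lam n m
  have hderiv : ∀ w : ℂ, HasDerivAt (fun w => Complex.exp (s * w) * Q.eval w)
      (Complex.exp (s * w) * (derivative Q + C (s : ℂ) * Q).eval w) w := by
    intro w
    have h1 : HasDerivAt (fun w : ℂ => Complex.exp (s * w)) (Complex.exp (s * w) * s) w := by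
      simpa using ((hasDerivAt_id w).const_mul (s : ℂ)).cexp
    refine (h1.fun_mul (Q.hasDerivAt w)).congr_deriv ?_
    rw [eval_add, eval_mul, eval_C]
    ring
  have hb := (convex_closedBall (0 : ℂ) 1).norm_image_sub_le_of_norm_hasDerivWithin_le
    (f := fun w => Complex.exp (s * w) * Q.eval w)
    (f' := fun w => Complex.exp (s * w) * (derivative Q + C (s : ℂ) * Q).eval w)
    (C := Real.exp Λ * (Λ * Real.exp (3 * Λ) / (n + γ - 1))) (x := 0) (y := z)
    (fun w _ => (hderiv w).hasDerivWithinAt) (fun w hw => ?_) (by simp) (by simpa using hz)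
  · simp only [h0, mul_zero, Complex.exp_zero, one_mul, zero_sub, norm_neg, sub_zero] at hb
    rw [eval_zero_hermitePadeDen hγ, norm_one] at hb
    have h2 : Real.exp Λ * (Λ * Real.exp (3 * Λ) / (n + γ - 1)) < 1 := by
      rw [mul_div_assoc', div_lt_one ha0]
      refine lt_of_eq_of_lt ?_ ha
      rw [show 4 * Λ = Λ + 3 * Λ by ring, Real.exp_add]
      ring
    have h3 : Real.exp Λ * (Λ * Real.exp (3 * Λ) / (n + γ - 1)) * ‖z‖
        ≤ Real.exp Λ * (Λ * Real.exp (3 * Λ) / (n + γ - 1)) :=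
      mul_le_of_le_one_right (by positivity) hz
    linarith
  · have hw' : ‖w‖ ≤ 1 := by simpa using hw
    rw [norm_mul]
    refine mul_le_mul ?_ (norm_eval_derivative_add_le hγ lam hn m ha0 hΛ0 hΛ hw') (norm_nonneg _)
      (Real.exp_pos _).le
    refine (Complex.norm_exp_le_exp_norm _).trans (Real.exp_le_exp.2 ?_)
    rw [norm_mul, Complex.norm_real, Real.norm_eq_abs]
    calc |s| * ‖w‖ ≤ Λ * 1 := by gcongr
      _ = Λ := mul_one _

/-! ### The integral representation -/

theorem integrableOn_rpow_mul_exp_neg {a b : ℝ} (ha : -1 < a) (hb : 0 < b) :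
    IntegrableOn (fun t : ℝ => t ^ a * Real.exp (-b * t)) (Set.Ioi 0) := by
  have := integrableOn_rpow_mul_exp_neg_mul_rpow (p := 1) ha one_pos hb
  simpa using this

theorem norm_cpow_mul_exp_neg {a t : ℝ} (ht : 0 < t) (r : ℂ) :
    ‖(t : ℂ) ^ (a : ℂ) * Complex.exp (-t * r)‖ = t ^ a * Real.exp (-r.re * t) := by
  rw [norm_mul, Complex.norm_cpow_eq_rpow_re_of_pos ht, Complex.norm_exp, Complex.ofReal_re,
    ← Complex.ofReal_neg, Complex.re_ofReal_mul]
  ring_nf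

theorem aestronglyMeasurable_cpow_mul_exp_neg (a : ℂ) (r : ℂ) :
    AEStronglyMeasurable (fun t : ℝ => (t : ℂ) ^ a * Complex.exp (-t * r))
      (volume.restrict (Set.Ioi 0)) := by
  refine ContinuousOn.aestronglyMeasurable ?_ measurableSet_Ioi
  refine ContinuousOn.mul ?_ (by fun_prop)
  intro t ht
  exact (Complex.continuousAt_ofReal_cpow_const t a (Or.inr (ne_of_gt ht))).continuousWithinAt

theorem integrableOn_cpow_mul_exp_neg {a : ℝ} (ha : -1 < a) {r : ℂ} (hr : 0 < r.re) :
    IntegrableOn (fun t : ℝ => (t : ℂ) ^ (a : ℂ) * Complex.exp (-t * r)) (Set.Ioi 0) := by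
  refine (integrableOn_rpow_mul_exp_neg ha hr).mono' (aestronglyMeasurable_cpow_mul_exp_neg _ _) ?_
  filter_upwards [ae_restrict_mem measurableSet_Ioi] with t ht
  exact (norm_cpow_mul_exp_neg ht r).le

theorem differentiableOn_integral_cpow_mul_exp_neg {a : ℝ} (ha : -1 < a) :
    DifferentiableOn ℂ (fun r : ℂ => ∫ t in Set.Ioi (0 : ℝ),
      (t : ℂ) ^ (a : ℂ) * Complex.exp (-t * r)) {r | 0 < r.re} := by
  intro r₀ hr₀
  have hr₀' : 0 < r₀.re := hr₀
  have hε : 0 < r₀.re / 2 := by positivity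
  have h := hasDerivAt_integral_of_dominated_loc_of_deriv_le
    (μ := volume.restrict (Set.Ioi (0 : ℝ)))
    (F := fun (r : ℂ) (t : ℝ) => (t : ℂ) ^ (a : ℂ) * Complex.exp (-t * r))
    (F' := fun (r : ℂ) (t : ℝ) => -((t : ℂ) ^ ((a + 1 : ℝ) : ℂ) * Complex.exp (-t * r)))
    (x₀ := r₀) (bound := fun t => t ^ (a + 1) * Real.exp (-(r₀.re / 2) * t))
    (Metric.ball_mem_nhds r₀ hε)
    (Eventually.of_forall fun r => aestronglyMeasurable_cpow_mul_exp_neg _ _)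
    (integrableOn_cpow_mul_exp_neg ha hr₀')
    (aestronglyMeasurable_cpow_mul_exp_neg _ _).neg ?_
    (integrableOn_rpow_mul_exp_neg (by linarith) hε) ?_
  · exact h.2.differentiableAt.differentiableWithinAt
  · filter_upwards [ae_restrict_mem measurableSet_Ioi] with t ht r hr
    have ht' : 0 < t := ht
    rw [norm_neg, norm_cpow_mul_exp_neg ht]
    have h1 : |(r - r₀).re| < r₀.re / 2 :=
      (Complex.abs_re_le_norm _).trans_lt (by simpa [dist_eq_norm] using hr)
    have h2 : r₀.re / 2 ≤ r.re := by
      rw [Complex.sub_re] at h1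
      linarith [(abs_lt.1 h1).1]
    gcongr
  · filter_upwards [ae_restrict_mem measurableSet_Ioi] with t ht r hr
    have ht' : (t : ℂ) ≠ 0 := by exact_mod_cast (ne_of_gt ht)
    have h1 : HasDerivAt (fun r : ℂ => Complex.exp (-t * r)) (Complex.exp (-t * r) * -t) r := by
      simpa using ((hasDerivAt_id r).const_mul (-(t : ℂ))).cexp
    refine (h1.const_mul ((t : ℂ) ^ (a : ℂ))).congr_deriv ?_
    push_cast
    rw [Complex.cpow_add _ _ ht', Complex.cpow_one]
    ring

/-- The Gamma integral with a complex rate. -/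
theorem integral_cpow_mul_exp_neg {a : ℝ} (ha : 0 < a) {r : ℂ} (hr : 0 < r.re) :
    ∫ t in Set.Ioi (0 : ℝ), (t : ℂ) ^ ((a - 1 : ℝ) : ℂ) * Complex.exp (-t * r)
      = (r⁻¹) ^ (a : ℂ) * (Real.Gamma a : ℂ) := by
  have hopen : IsOpen {r : ℂ | 0 < r.re} := isOpen_lt continuous_const Complex.continuous_re
  have h1 := (differentiableOn_integral_cpow_mul_exp_neg (a := a - 1)
    (by linarith)).analyticOnNhd hopen
  have h2 : AnalyticOnNhd ℂ (fun r : ℂ => (r⁻¹) ^ (a : ℂ) * (Real.Gamma a : ℂ)) {r | 0 < r.re} := by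
    refine DifferentiableOn.analyticOnNhd ?_ hopen
    intro z hz
    have hz' : 0 < z.re := hz
    have hz0 : z ≠ 0 := fun h => by rw [h] at hz'; simp at hz'
    have hs : z⁻¹ ∈ Complex.slitPlane := by
      left
      rw [Complex.inv_re]
      exact div_pos hz' (Complex.normSq_pos.2 hz0)
    exact (((differentiableAt_inv hz0).cpow (differentiableAt_const _) hs).mul
      (differentiableAt_const _)).differentiableWithinAt
  -- Identity theorem: both sides are analytic on the right half-plane and agree at the real points
  -- 1 + 1/(l + 1), which accumulate at 1.
  refine h1.eqOn_of_preconnected_of_frequently_eq h2 (convex_halfSpace_re_gt 0).isPreconnected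
    (z₀ := 1) (by simp) ?_ hr
  have hseq : Tendsto (fun l : ℕ => (((1 + 1 / ((l : ℝ) + 1) : ℝ)) : ℂ)) atTop (𝓝[≠] 1) := by
    refine tendsto_nhdsWithin_iff.2 ⟨?_, Eventually.of_forall fun l => ?_⟩
    · have h := (tendsto_one_div_add_atTop_nhds_zero_nat (𝕜 := ℝ)).const_add 1
      rw [add_zero] at h
      have := (Complex.continuous_ofReal.tendsto 1).comp h
      rwa [Complex.ofReal_one] at this
    · have : (1 + 1 / ((l : ℝ) + 1)) ≠ 1 := by
        have : 0 < 1 / ((l : ℝ) + 1) := by positivity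
        linarith
      simpa only [Set.mem_compl_iff, Set.mem_singleton_iff, ne_eq, Complex.ofReal_eq_one] using this
  refine hseq.frequently (Eventually.of_forall fun l => ?_).frequently
  have hρ : 0 < 1 + 1 / ((l : ℝ) + 1) := by positivity
  set ρ := 1 + 1 / ((l : ℝ) + 1)
  have h := Complex.integral_cpow_mul_exp_neg_mul_Ioi (a := a) (by simpa using ha) hρ
  rw [one_div, Complex.Gamma_ofReal] at h
  rw [← h]
  refine setIntegral_congr_fun measurableSet_Ioi fun t _ => ?_
  push_cast
  rw [show (-(t : ℂ) * (ρ : ℂ)) = -(ρ * t) by ring]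

theorem Gamma_add_natCast_eq {γ : ℝ} (hγ : ∀ p : ℕ, γ ≠ -(p : ℝ)) (l : ℕ) :
    Real.Gamma (γ + l) = risingFact γ l * Real.Gamma γ := by
  induction l with
  | zero => simp [risingFact]
  | succ l ih =>
    have h : γ + l ≠ 0 := fun h => hγ l (by linarith)
    rw [Nat.cast_succ, ← add_assoc, Real.Gamma_add_one h, ih, risingFact_succ]
    ring

theorem eval_prod_eq_sum_nodePoly {k : ℕ} (lam : Fin k → ℝ) (m : Fin k → ℕ) (t : ℂ) :
    ∏ p, (t - (lam p : ℂ)) ^ m p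
      = ∑ p ∈ Finset.range (∑ i, m i + 1), ((nodePoly lam m).coeff p : ℂ) * t ^ p := by
  have h : ((nodePoly lam m).map (algebraMap ℝ ℂ)).eval t = ∏ p, (t - (lam p : ℂ)) ^ m p := by
    rw [map_nodePoly, eval_prod]; simp
  rw [← h, eval_eq_sum_range, (monic_nodePoly lam m).natDegree_map, natDegree_nodePoly]
  simp [coeff_map]

theorem kernelU_eq_sum {k : ℕ} (γ : ℝ) (lam : Fin k → ℝ) (n : ℕ) (m : Fin k → ℕ) {t : ℂ}
    (ht : t ≠ 0) : kernelU γ lam n m t = ∑ p ∈ Finset.range (∑ i, m i + 1),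
      ((nodePoly lam m).coeff p : ℂ) * t ^ ((n + p + γ - 1 : ℝ) : ℂ) := by
  rw [kernelU, eval_prod_eq_sum_nodePoly, Finset.mul_sum]
  refine Finset.sum_congr rfl fun p _ => ?_
  have : ((n + p + γ - 1 : ℝ) : ℂ) = ((n : ℂ) + γ - 1) + (p : ℕ) := by push_cast; ring
  rw [this, Complex.cpow_add _ _ ht, Complex.cpow_natCast]
  ring

/-- The Gamma values reproduce the rising factorials in the coefficients of Q, and the sum becomes
r^{-(n+M+γ)} Γ(n + M + γ) Q(r). The power has modulus 1, because its exponent is real and |r| = 1.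
-/
theorem norm_sum_cpow_mul_Gamma {k : ℕ} {γ : ℝ} (hγ : ∀ p : ℕ, γ ≠ -(p : ℝ)) (lam : Fin k → ℝ)
    (n : ℕ) (m : Fin k → ℕ) (hN : 0 < n + (∑ i, m i : ℕ) + γ) {r : ℂ} (hr : ‖r‖ = 1) :
    ‖∑ p ∈ Finset.range (∑ i, m i + 1), ((nodePoly lam m).coeff p : ℂ)
      * ((r⁻¹) ^ ((n + p + γ : ℝ) : ℂ) * (Real.Gamma (n + p + γ) : ℂ))‖
      = Real.Gamma (n + (∑ i, m i : ℕ) + γ) * ‖(hermitePadeDen γ lam n m).eval r‖ := by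
  have hr0 : r ≠ 0 := fun h => by simp [h] at hr
  set M := ∑ i, m i with hM
  have key : ∑ p ∈ Finset.range (M + 1), ((nodePoly lam m).coeff p : ℂ)
      * ((r⁻¹) ^ ((n + p + γ : ℝ) : ℂ) * (Real.Gamma (n + p + γ) : ℂ))
      = (r⁻¹) ^ ((n + (M : ℝ) + γ : ℝ) : ℂ) * ((Real.Gamma (n + M + γ) : ℂ)
        * (hermitePadeDen γ lam n m).eval r) := by
    rw [eval_eq_sum_range' (Nat.lt_succ_of_le (natDegree_hermitePadeDen_le γ lam n m)),
      Finset.mul_sum, Finset.mul_sum, ← hM, ← Finset.sum_range_reflect]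
    refine Finset.sum_congr rfl fun q hq => ?_
    have hq' : q ≤ M := Nat.lt_succ_iff.1 (Finset.mem_range.1 hq)
    rw [show M + 1 - 1 - q = M - q by omega, coeff_hermitePadeDen, if_pos hq', ← hM]
    have h1 : (r⁻¹) ^ ((n + (M : ℝ) + γ : ℝ) : ℂ)
        = (r⁻¹) ^ ((n + ((M - q : ℕ) : ℝ) + γ : ℝ) : ℂ) * (r⁻¹) ^ q := by
      rw [← Complex.cpow_natCast, ← Complex.cpow_add _ _ (inv_ne_zero hr0),
        Nat.cast_sub hq']
      congr 1
      push_cast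
      ring
    have h2 : Real.Gamma (n + ((M - q : ℕ) : ℝ) + γ) = Real.Gamma (n + M + γ)
        * (risingFact γ (n + (M - q)) / risingFact γ (n + M)) := by
      have e1 := Gamma_add_natCast_eq hγ (n + (M - q))
      have e2 := Gamma_add_natCast_eq hγ (n + M)
      have h0 := risingFact_ne_zero hγ (n + M)
      rw [Nat.cast_add, add_comm γ] at e1 e2
      rw [e1, e2]
      field_simp
    rw [h1, h2, inv_pow]
    push_cast
    field_simp
  rw [key, norm_mul, norm_mul, Complex.norm_real, Real.norm_eq_abs,
    abs_of_pos (Real.Gamma_pos_of_pos hN), Complex.norm_cpow_of_ne_zero (inv_ne_zero hr0),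
    norm_inv, hr, Complex.ofReal_im]
  simp

theorem cpow_ofReal_mul {s : ℝ} (hs : 0 < s) {z : ℂ} (hz : z ≠ 0) (a : ℂ) :
    ((s : ℂ) * z) ^ a = (s : ℂ) ^ a * z ^ a := by
  have hs' : (s : ℂ) ≠ 0 := by exact_mod_cast hs.ne'
  rw [Complex.cpow_def_of_ne_zero (mul_ne_zero hs' hz), Complex.cpow_def_of_ne_zero hs',
    Complex.cpow_def_of_ne_zero hz, Complex.log_ofReal_mul hs hz, ← Complex.exp_add,
    Complex.ofReal_log hs.le]
  ring_nf

/-- The integral of the kernel over the positive half-line. -/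
theorem integral_kernelU_Ioi {k : ℕ} {γ : ℝ} (lam : Fin k → ℝ) (n : ℕ) (m : Fin k → ℕ)
    (hn : 0 < n + γ) {r : ℂ} (hr : 0 < r.re) :
    IntegrableOn (fun t : ℝ => kernelU γ lam n m t * Complex.exp (-t * r)) (Set.Ioi 0) ∧
    ∫ t in Set.Ioi (0 : ℝ), kernelU γ lam n m t * Complex.exp (-t * r)
      = ∑ p ∈ Finset.range (∑ i, m i + 1), ((nodePoly lam m).coeff p : ℂ)
        * ((r⁻¹) ^ ((n + p + γ : ℝ) : ℂ) * (Real.Gamma (n + p + γ) : ℂ)) := by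
  have hpos : ∀ p : ℕ, (0 : ℝ) < n + p + γ := fun p => by
    linarith [(Nat.cast_nonneg p : (0 : ℝ) ≤ p)]
  have hint : ∀ p ∈ Finset.range (∑ i, m i + 1), IntegrableOn (fun t : ℝ =>
      ((nodePoly lam m).coeff p : ℂ) * ((t : ℂ) ^ ((n + p + γ - 1 : ℝ) : ℂ)
        * Complex.exp (-t * r))) (Set.Ioi 0) := fun p _ =>
    (integrableOn_cpow_mul_exp_neg (by linarith [hpos p]) hr).const_mul _
  have hcongr : Set.EqOn (fun t : ℝ => ∑ p ∈ Finset.range (∑ i, m i + 1),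
      ((nodePoly lam m).coeff p : ℂ) * ((t : ℂ) ^ ((n + p + γ - 1 : ℝ) : ℂ)
        * Complex.exp (-t * r))) (fun t : ℝ => kernelU γ lam n m t * Complex.exp (-t * r))
      (Set.Ioi 0) := by
    intro t ht
    have ht' : (t : ℂ) ≠ 0 := by exact_mod_cast (ne_of_gt ht)
    simp only [kernelU_eq_sum γ lam n m ht', Finset.sum_mul, mul_assoc]
  constructor
  · exact IntegrableOn.congr_fun (integrable_finsetSum _ hint) hcongr measurableSet_Ioi
  · rw [← setIntegral_congr_fun measurableSet_Ioi hcongr, integral_finsetSum _ hint]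
    refine Finset.sum_congr rfl fun p _ => ?_
    rw [integral_const_mul, integral_cpow_mul_exp_neg (hpos p) hr]

/-- The integral of the kernel over the ray `t = s z`, `s > 0`. -/
theorem integral_kernelU_ray {k : ℕ} {γ : ℝ} (lam : Fin k → ℝ) (n : ℕ) (m : Fin k → ℕ)
    (hn : 0 < n + γ) {z : ℂ} (hz : z ≠ 0) :
    IntegrableOn (fun s : ℝ => kernelU γ lam n m (s * z) * Complex.exp (-s) * z) (Set.Ioi 0) ∧
    ∫ s in Set.Ioi (0 : ℝ), kernelU γ lam n m (s * z) * Complex.exp (-s) * z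
      = ∑ p ∈ Finset.range (∑ i, m i + 1), ((nodePoly lam m).coeff p : ℂ)
        * (z ^ ((n + p + γ : ℝ) : ℂ) * (Real.Gamma (n + p + γ) : ℂ)) := by
  have hpos : ∀ p : ℕ, (0 : ℝ) < n + p + γ := fun p => by
    linarith [(Nat.cast_nonneg p : (0 : ℝ) ≤ p)]
  -- On the ray a power of `z` factors out of each term and leaves a Gamma integral of rate 1, so no
  -- rotation of the contour is needed.
  have hint : ∀ p ∈ Finset.range (∑ i, m i + 1), IntegrableOn (fun t : ℝ =>
      ((nodePoly lam m).coeff p : ℂ) * z ^ ((n + p + γ : ℝ) : ℂ)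
        * ((t : ℂ) ^ ((n + p + γ - 1 : ℝ) : ℂ) * Complex.exp (-t * 1))) (Set.Ioi 0) := fun p _ =>
    (integrableOn_cpow_mul_exp_neg (by linarith [hpos p]) (by simp)).const_mul _
  have hcongr : Set.EqOn (fun t : ℝ => ∑ p ∈ Finset.range (∑ i, m i + 1),
      ((nodePoly lam m).coeff p : ℂ) * z ^ ((n + p + γ : ℝ) : ℂ)
        * ((t : ℂ) ^ ((n + p + γ - 1 : ℝ) : ℂ) * Complex.exp (-t * 1)))
      (fun t : ℝ => kernelU γ lam n m (t * z) * Complex.exp (-t) * z) (Set.Ioi 0) := by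
    intro t ht
    have ht' : (t : ℂ) ≠ 0 := by exact_mod_cast (ne_of_gt ht)
    simp only [kernelU_eq_sum γ lam n m (mul_ne_zero ht' hz), Finset.sum_mul, mul_one]
    refine Finset.sum_congr rfl fun p _ => ?_
    rw [cpow_ofReal_mul ht hz]
    have e : z ^ ((n + p + γ : ℝ) : ℂ) = z ^ ((n + p + γ - 1 : ℝ) : ℂ) * z := by
      rw [show ((n + p + γ : ℝ) : ℂ) = ((n + p + γ - 1 : ℝ) : ℂ) + 1 by push_cast; ring,
        Complex.cpow_add _ _ hz, Complex.cpow_one]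
    rw [e]
    ring
  constructor
  · exact IntegrableOn.congr_fun (integrable_finsetSum _ hint) hcongr measurableSet_Ioi
  · rw [← setIntegral_congr_fun measurableSet_Ioi hcongr, integral_finsetSum _ hint]
    refine Finset.sum_congr rfl fun p _ => ?_
    rw [integral_const_mul, integral_cpow_mul_exp_neg (hpos p) (by simp)]
    simp [mul_assoc]

/-! ### Absolutely summable power series on the unit circle -/

/-- The coefficients of the power series are absolutely summable. -/
def PowerSeries.AbsSummable (f : PowerSeries ℂ) : Prop :=
  Summable fun l => ‖PowerSeries.coeff l f‖

/-- The sum of a power series at a point. -/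
noncomputable def PowerSeries.sumAt (f : PowerSeries ℂ) (z : ℂ) : ℂ :=
  ∑' l, PowerSeries.coeff l f * z ^ l

namespace PowerSeries.AbsSummable

open PowerSeries

variable {f g : PowerSeries ℂ} {z : ℂ}

theorem summable_norm (hf : f.AbsSummable) (hz : ‖z‖ ≤ 1) :
    Summable fun l => ‖coeff l f * z ^ l‖ := by
  refine Summable.of_nonneg_of_le (fun _ => norm_nonneg _) (fun l => ?_) hf
  rw [norm_mul, norm_pow]
  exact mul_le_of_le_one_right (norm_nonneg _) (pow_le_one₀ (norm_nonneg _) hz)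

theorem hasSum (hf : f.AbsSummable) (hz : ‖z‖ ≤ 1) :
    HasSum (fun l => coeff l f * z ^ l) (f.sumAt z) :=
  (hf.summable_norm hz).of_norm.hasSum

theorem sub (hf : f.AbsSummable) (hg : g.AbsSummable) : (f - g).AbsSummable := by
  refine Summable.of_nonneg_of_le (fun _ => norm_nonneg _) (fun l => ?_) (Summable.add hf hg)
  rw [map_sub]
  exact norm_sub_le _ _

theorem sumAt_sub (hf : f.AbsSummable) (hg : g.AbsSummable) (hz : ‖z‖ ≤ 1) :
    (f - g).sumAt z = f.sumAt z - g.sumAt z := by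
  refine HasSum.unique ((hf.sub hg).hasSum hz) ?_
  refine ((hf.hasSum hz).sub (hg.hasSum hz)).congr_fun fun l => ?_
  rw [map_sub, sub_mul]

theorem mul (hf : f.AbsSummable) (hg : g.AbsSummable) : (f * g).AbsSummable := by
  have := summable_norm_sum_mul_antidiagonal_of_summable_norm hf hg
  exact this.congr fun l => by rw [coeff_mul]

theorem sumAt_mul (hf : f.AbsSummable) (hg : g.AbsSummable) (hz : ‖z‖ ≤ 1) :
    (f * g).sumAt z = f.sumAt z * g.sumAt z := by
  rw [sumAt, sumAt, sumAt, tsum_mul_tsum_eq_tsum_sum_antidiagonal_of_summable_norm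
    (hf.summable_norm hz) (hg.summable_norm hz)]
  refine tsum_congr fun l => ?_
  rw [coeff_mul, Finset.sum_mul]
  refine Finset.sum_congr rfl fun p hp => ?_
  rw [← Finset.HasAntidiagonal.mem_antidiagonal.1 hp, pow_add]
  ring

theorem _root_.Polynomial.absSummable_coe (P : ℂ[X]) : (P : PowerSeries ℂ).AbsSummable := by
  refine summable_of_ne_finset_zero (s := Finset.range (P.natDegree + 1)) fun l hl => ?_
  rw [Polynomial.coeff_coe, coeff_eq_zero_of_natDegree_lt
    (by simp only [Finset.mem_range] at hl; omega), norm_zero]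

theorem _root_.Polynomial.sumAt_coe (P : ℂ[X]) (z : ℂ) :
    (P : PowerSeries ℂ).sumAt z = P.eval z := by
  rw [sumAt, eval_eq_sum_range, tsum_eq_sum (s := Finset.range (P.natDegree + 1)) fun l hl => ?_]
  · simp
  · rw [Polynomial.coeff_coe, coeff_eq_zero_of_natDegree_lt
      (by simp only [Finset.mem_range] at hl; omega), zero_mul]

theorem exists_inverse_X_sub_C {a : ℂ} (ha : 1 < ‖a‖) :
    ∃ A : PowerSeries ℂ, A.AbsSummable ∧ ((Polynomial.X - Polynomial.C a : ℂ[X]) : PowerSeries ℂ) * A = 1 := by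
  have ha0 : a ≠ 0 := fun h => by rw [h, norm_zero] at ha; linarith
  refine ⟨PowerSeries.mk fun l => -(a⁻¹) ^ (l + 1), ?_, ?_⟩
  · have h : Summable fun l : ℕ => ‖a⁻¹‖ * ‖a⁻¹‖ ^ l :=
      (summable_geometric_of_lt_one (norm_nonneg _)
        (by rw [norm_inv]; exact inv_lt_one_of_one_lt₀ ha)).mul_left _
    refine h.congr fun l => ?_
    rw [coeff_mk, norm_neg, norm_pow, pow_succ']
  · ext l
    rw [Polynomial.coe_sub, Polynomial.coe_X, Polynomial.coe_C, sub_mul, map_sub, PowerSeries.coeff_C_mul,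
      coeff_mk, coeff_one]
    cases l with
    | zero => rw [coeff_zero_X_mul]; simp [ha0]
    | succ l =>
      rw [coeff_succ_X_mul, coeff_mk, if_neg (Nat.succ_ne_zero l), pow_succ (a⁻¹) (l + 1)]
      field_simp
      ring

theorem exists_inverse_prod (s : Multiset ℂ) (hs : ∀ a ∈ s, 1 < ‖a‖) :
    ∃ A : PowerSeries ℂ, A.AbsSummable ∧
      (((s.map fun a => Polynomial.X - Polynomial.C a).prod : ℂ[X]) : PowerSeries ℂ) * A = 1 := by
  induction s using Multiset.induction with
  | empty => exact ⟨((1 : ℂ[X]) : PowerSeries ℂ), absSummable_coe 1, by simp⟩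
  | cons a s ih =>
    obtain ⟨A, hA, hA1⟩ := ih fun b hb => hs b (Multiset.mem_cons_of_mem hb)
    obtain ⟨B, hB, hB1⟩ := exists_inverse_X_sub_C (hs a (Multiset.mem_cons_self a s))
    refine ⟨B * A, hB.mul hA, ?_⟩
    rw [Multiset.map_cons, Multiset.prod_cons, Polynomial.coe_mul, mul_mul_mul_comm, hA1, hB1,
      one_mul]

/-- A polynomial without zeros in the closed unit disc has an absolutely summable inverse. -/
theorem exists_inverse {Q : ℂ[X]} (hQ : ∀ z : ℂ, ‖z‖ ≤ 1 → Q.eval z ≠ 0) :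
    ∃ A : PowerSeries ℂ, A.AbsSummable ∧ (Q : PowerSeries ℂ) * A = 1 := by
  have hQ0 : Q ≠ 0 := fun h => hQ 0 (by simp) (by simp [h])
  obtain ⟨A, hA, hA1⟩ := exists_inverse_prod Q.roots fun a ha => by
    by_contra! h
    exact hQ a h (isRoot_of_mem_roots ha)
  have hl : Q.leadingCoeff ≠ 0 := leadingCoeff_ne_zero.2 hQ0
  refine ⟨((Polynomial.C (Q.leadingCoeff)⁻¹ : ℂ[X]) : PowerSeries ℂ) * A, (absSummable_coe _).mul hA, ?_⟩
  have hsplit := (IsAlgClosed.splits Q).eq_prod_roots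
  have e : (Q : PowerSeries ℂ) = ((Polynomial.C Q.leadingCoeff : ℂ[X]) : PowerSeries ℂ)
      * (((Q.roots.map fun a => Polynomial.X - Polynomial.C a).prod : ℂ[X]) : PowerSeries ℂ) := by
    rw [← Polynomial.coe_mul]
    exact congrArg _ hsplit
  rw [e, mul_mul_mul_comm, hA1, ← Polynomial.coe_mul, ← Polynomial.C_mul, mul_inv_cancel₀ hl]
  simp

end PowerSeries.AbsSummable

theorem absSummable_systemE {k : ℕ} (γ : ℝ) (lam : Fin k → ℝ) (j : Fin k) :
    (systemE γ lam j).AbsSummable := by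
  have h := summable_systemG γ (lam j) 0
  simp only [mul_zero, Real.cos_zero, mul_one] at h
  refine h.norm.congr fun l => ?_
  rw [systemE, PowerSeries.coeff_mk, Complex.norm_real]

theorem norm_exp_I_mul (x : ℝ) : ‖Complex.exp (Complex.I * x)‖ = 1 := by
  rw [mul_comm, Complex.norm_exp_ofReal_mul_I]

theorem re_mul_exp_I_mul_pow (c : ℂ) (x : ℝ) (l : ℕ) :
    (c * Complex.exp (Complex.I * x) ^ l).re = c.re * Real.cos (l * x) + -c.im * Real.sin (l * x) := by
  rw [← cexpI_natCast, cexpI_eq_cos_add_sin, Int.cast_natCast, Complex.mul_re,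
    Complex.add_re, Complex.add_im, Complex.re_ofReal_mul, Complex.im_ofReal_mul,
    Complex.ofReal_re, Complex.ofReal_im, Complex.I_re, Complex.I_im]
  ring

theorem systemG_eq_re {k : ℕ} (γ : ℝ) (lam : Fin k → ℝ) (j : Fin k) (x : ℝ) :
    systemG γ lam j x = ((systemE γ lam j).sumAt (Complex.exp (Complex.I * x))).re := by
  have h := Complex.hasSum_re ((absSummable_systemE γ lam j).hasSum (norm_exp_I_mul x).le)
  rw [systemG, ← h.tsum_eq]
  refine tsum_congr fun l => ?_
  rw [re_mul_exp_I_mul_pow, systemE, PowerSeries.coeff_mk, Complex.ofReal_re, Complex.ofReal_im]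
  ring

/-- The real part of an absolutely summable power series divisible by `z ^ N` is, on the unit
circle, a trigonometric series that starts with the frequency `N`. -/
theorem isTrigSeriesFrom_re {f : PowerSeries ℂ} (hf : f.AbsSummable) {N : ℕ}
    (hN : ∀ l < N, PowerSeries.coeff l f = 0) :
    IsTrigSeriesFrom N fun x => ((f.sumAt (Complex.exp (Complex.I * x))).re : ℂ) := by
  refine ⟨fun l => ((PowerSeries.coeff l f).re : ℂ), fun l => ((-(PowerSeries.coeff l f).im : ℝ) : ℂ),
    fun x => ?_⟩
  have h := (Complex.hasSum_ofReal.2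
    (Complex.hasSum_re (hf.hasSum (norm_exp_I_mul x).le))).tendsto_sum_nat
  refine h.congr' ?_
  filter_upwards [eventually_ge_atTop N] with L hL
  rw [Finset.range_eq_Ico, ← Finset.sum_Ico_consecutive _ (Nat.zero_le N) hL,
    Finset.sum_eq_zero fun l hl => ?_, zero_add]
  · refine Finset.sum_congr rfl fun l _ => ?_
    rw [re_mul_exp_I_mul_pow]
    push_cast
    ring
  · rw [hN l (Finset.mem_Ico.1 hl).2]; simp

/-! ### Trigonometric polynomials -/

theorem isTrigPoly_cexpI {d : ℕ} {p : ℤ} (h1 : -(d : ℤ) ≤ p) (h2 : p ≤ d) :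
    IsTrigPoly d (cexpI p) := by
  refine ⟨fun q => if q = p then 1 else 0, fun x => ?_⟩
  rw [Finset.sum_eq_single p]
  · simp [cexpI]
  · intro q _ hq; simp [hq]
  · intro h; exact absurd (Finset.mem_Icc.2 ⟨h1, h2⟩) h

theorem IsTrigPoly.const_mul {d : ℕ} {T : ℝ → ℂ} (hT : IsTrigPoly d T) (c : ℂ) :
    IsTrigPoly d fun x => c * T x := by
  obtain ⟨u, hu⟩ := hT
  refine ⟨fun p => c * u p, fun x => ?_⟩
  simp only [hu x, Finset.mul_sum, mul_assoc]

theorem IsTrigPoly.add {d : ℕ} {T S : ℝ → ℂ} (hT : IsTrigPoly d T) (hS : IsTrigPoly d S) :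
    IsTrigPoly d fun x => T x + S x := by
  obtain ⟨u, hu⟩ := hT
  obtain ⟨v, hv⟩ := hS
  refine ⟨fun p => u p + v p, fun x => ?_⟩
  simp only [hu x, hv x, ← Finset.sum_add_distrib, add_mul]

theorem IsTrigPoly.sum {ι : Type*} {d : ℕ} (s : Finset ι) {T : ι → ℝ → ℂ}
    (hT : ∀ i ∈ s, IsTrigPoly d (T i)) : IsTrigPoly d fun x => ∑ i ∈ s, T i x := by
  induction s using Finset.cons_induction with
  | empty => exact ⟨0, fun x => by simp⟩
  | cons a s ha ih =>
    simp only [Finset.sum_cons]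
    exact (hT a (Finset.mem_cons_self a s)).add
      (ih fun i hi => hT i (Finset.mem_cons_of_mem hi))

theorem IsTrigPoly.conj {d : ℕ} {T : ℝ → ℂ} (hT : IsTrigPoly d T) :
    IsTrigPoly d fun x => (starRingEnd ℂ) (T x) := by
  obtain ⟨u, hu⟩ := hT
  have : (fun x => (starRingEnd ℂ) (T x))
      = fun x => ∑ p ∈ Finset.Icc (-(d : ℤ)) d, (starRingEnd ℂ) (u p) * cexpI (-p) x := by
    funext x
    rw [hu x, map_sum]
    refine Finset.sum_congr rfl fun p _ => ?_
    rw [map_mul, ← conj_cexpI, cexpI]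
  rw [this]
  refine IsTrigPoly.sum _ fun p hp => ?_
  have := Finset.mem_Icc.1 hp
  exact (isTrigPoly_cexpI (by omega) (by omega)).const_mul _

theorem IsTrigPoly.re {d : ℕ} {T : ℝ → ℂ} (hT : IsTrigPoly d T) :
    IsTrigPoly d fun x => ((T x).re : ℂ) := by
  have : (fun x => ((T x).re : ℂ)) = fun x => (1 / 2 : ℂ) * (T x + (starRingEnd ℂ) (T x)) := by
    funext x
    rw [Complex.add_conj]
    push_cast
    ring
  rw [this]
  exact (hT.add hT.conj).const_mul _

theorem isTrigPoly_eval_mul_conj_eval {P Q : ℂ[X]} {d e : ℕ} (hP : P.natDegree ≤ d)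
    (hQ : Q.natDegree ≤ e) (hed : e ≤ d) :
    IsTrigPoly d fun x : ℝ => P.eval (Complex.exp (Complex.I * x))
      * (starRingEnd ℂ) (Q.eval (Complex.exp (Complex.I * x))) := by
  have : (fun x : ℝ => P.eval (Complex.exp (Complex.I * x))
      * (starRingEnd ℂ) (Q.eval (Complex.exp (Complex.I * x))))
      = fun x => ∑ p ∈ Finset.range (d + 1), ∑ q ∈ Finset.range (e + 1),
        (P.coeff p * (starRingEnd ℂ) (Q.coeff q)) * cexpI ((p : ℤ) + -(q : ℤ)) x := by
    funext x
    rw [eval_eq_sum_range' (Nat.lt_succ_of_le hP), eval_eq_sum_range' (Nat.lt_succ_of_le hQ),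
      map_sum, Finset.sum_mul_sum]
    refine Finset.sum_congr rfl fun p _ => Finset.sum_congr rfl fun q _ => ?_
    rw [map_mul, ← cexpI_natCast, ← cexpI_natCast, conj_cexpI, cexpI_add]
    ring
  rw [this]
  refine IsTrigPoly.sum _ fun p hp => IsTrigPoly.sum _ fun q hq => ?_
  have := Finset.mem_range.1 hp
  have := Finset.mem_range.1 hq
  exact (isTrigPoly_cexpI (by omega) (by omega)).const_mul _

/-! ### Hermite–Jacobi approximations -/

/-- Source of the denominator |Q|²: it writes the real part of an algebraic fraction on the circle
as a fraction of trigonometric polynomials. -/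
theorem re_mul_conj_div (a b : ℂ) :
    ((a * (starRingEnd ℂ) b).re : ℂ) / (b * (starRingEnd ℂ) b) = ((a / b).re : ℂ) := by
  rw [Complex.mul_conj, ← Complex.ofReal_div, Complex.div_re, Complex.mul_re, Complex.conj_re,
    Complex.conj_im]
  congr 1
  ring

section

variable {k : ℕ} {γ : ℝ} {lam : Fin k → ℝ} {n : ℕ} {m : Fin k → ℕ} {Q : ℂ[X]} {P : Fin k → ℂ[X]}

/-- The Hermite–Padé fractions and their remainders as power series. -/
theorem exists_remainder (hQ : ∀ z : ℂ, ‖z‖ ≤ 1 → Q.eval z ≠ 0)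
    (h : IsHermitePade (systemE γ lam) n m Q P) (j : Fin k) :
    ∃ A R : PowerSeries ℂ, A.AbsSummable ∧ R.AbsSummable ∧
      (∀ z : ℂ, ‖z‖ ≤ 1 → A.sumAt z = (P j).eval z / Q.eval z) ∧
      R = systemE γ lam j - A ∧
      (Q : PowerSeries ℂ) * R = (Q : PowerSeries ℂ) * systemE γ lam j - (P j : PowerSeries ℂ) ∧
      ∀ l ≤ n + ∑ i, m i, PowerSeries.coeff l R = 0 := by
  obtain ⟨B, hB, hB1⟩ := PowerSeries.AbsSummable.exists_inverse hQ
  have hA := ((P j).absSummable_coe).mul hB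
  have hQR : (Q : PowerSeries ℂ) * (systemE γ lam j - (P j : PowerSeries ℂ) * B)
      = (Q : PowerSeries ℂ) * systemE γ lam j - (P j : PowerSeries ℂ) := by
    linear_combination (-(P j : PowerSeries ℂ)) * hB1
  refine ⟨_, _, hA, (absSummable_systemE γ lam j).sub hA, fun z hz => ?_, rfl, hQR, fun l hl => ?_⟩
  · rw [((P j).absSummable_coe).sumAt_mul hB hz, Polynomial.sumAt_coe, div_eq_mul_inv]
    congr 1
    have h1 := (Q.absSummable_coe).sumAt_mul hB hz
    rw [hB1, Polynomial.sumAt_coe, ← Polynomial.coe_one, Polynomial.sumAt_coe, eval_one] at h1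
    exact eq_inv_of_mul_eq_one_right h1.symm
  · have e : systemE γ lam j - (P j : PowerSeries ℂ) * B
        = B * ((Q : PowerSeries ℂ) * systemE γ lam j - (P j : PowerSeries ℂ)) := by
      rw [← hQR]
      linear_combination (-(systemE γ lam j - (P j : PowerSeries ℂ) * B)) * hB1
    rw [e, PowerSeries.coeff_mul]
    refine Finset.sum_eq_zero fun p hp => ?_
    have := Finset.HasAntidiagonal.mem_antidiagonal.1 hp
    rw [(h.2.2 j).2 p.2 (by omega), mul_zero]

/-- G_γ is the real part of E_γ on the circle, since the coefficients are real, so all claims are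
real parts of claims about P_j / Q and the remainder. The frequencies of P_j conj Q lie between -M
and n_j, and `m j ≤ n` gives M ≤ n_j. -/
theorem isTrigHermiteJacobi_re (hm : ∀ j, m j ≤ n) (hQ : ∀ z : ℂ, ‖z‖ ≤ 1 → Q.eval z ≠ 0)
    (h : IsHermitePade (systemE γ lam) n m Q P) :
    IsTrigHermiteJacobi (systemG γ lam) n m
      (fun x => Q.eval (Complex.exp (Complex.I * x))
        * (starRingEnd ℂ) (Q.eval (Complex.exp (Complex.I * x))))
      (fun j x => (((P j).eval (Complex.exp (Complex.I * x))
        * (starRingEnd ℂ) (Q.eval (Complex.exp (Complex.I * x)))).re : ℂ)) := by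
  refine ⟨fun x => ?_, isTrigPoly_eval_mul_conj_eval h.2.1 h.2.1 le_rfl, fun j => ⟨?_, ?_⟩⟩
  · have := hQ _ (norm_exp_I_mul x).le
    exact mul_ne_zero this ((_root_.map_ne_zero _).2 this)
  · have := hm j
    exact (isTrigPoly_eval_mul_conj_eval (h.2.2 j).1 h.2.1 (by omega)).re
  · obtain ⟨A, R, hA, hR, hAz, hRA, hQR, hR0⟩ := exists_remainder hQ h j
    simp only [re_mul_conj_div]
    constructor
    · have := isTrigSeriesFrom_re hA (N := 0) (fun l hl => absurd hl (Nat.not_lt_zero l))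
      simpa only [hAz _ (norm_exp_I_mul _).le] using this
    · have := isTrigSeriesFrom_re hR (N := n + ∑ i, m i + 1) fun l hl => hR0 l (by omega)
      simpa only [hRA, (absSummable_systemE γ lam j).sumAt_sub hA (norm_exp_I_mul _).le,
        hAz _ (norm_exp_I_mul _).le, Complex.sub_re, ← systemG_eq_re, Complex.ofReal_sub] using this

end

/-! ### Fourier coefficients of products with trigonometric polynomials -/

/-- The coefficients of frequencies below `N` of an absolutely convergent Fourier series vanish
if its sum is a trigonometric series that starts with the frequency `N`. -/
theorem IsTrigSeriesFrom.coeff_eq_zero {N : ℕ} (hN : 0 < N) {g : ℝ → ℂ}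
    (hg : IsTrigSeriesFrom N g) {c : ℤ → ℂ}
    (hc : ∀ x, HasSum (fun q : ℤ => c q * cexpI q x) (g x)) {q : ℤ} (h1 : -(N : ℤ) < q)
    (h2 : q < N) : c q = 0 := by
  obtain ⟨a, b, hab⟩ := hg
  -- The exponential form of the given series. Its difference with the absolutely convergent one has
  -- sum zero everywhere, and Cantor's theorem applies.
  set d : ℤ → ℂ := fun q => if (N : ℤ) ≤ q then (a q.toNat - b q.toNat * Complex.I) / 2
    else if q ≤ -(N : ℤ) then (a (-q).toNat + b (-q).toNat * Complex.I) / 2 else 0 with hd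
  have hd0 : ∀ q : ℤ, -(N : ℤ) < q → q < N → d q = 0 := fun q h1 h2 => by
    simp only [hd]
    rw [if_neg (by omega), if_neg (by omega)]
  have key := coeff_eq_zero_of_tendsto (c := fun q => c q - d q) (fun x => ?_) q
  · simpa [hd0 q h1 h2] using key
  · have e1 := (hc x).nat_add_neg.tendsto_sum_nat
    have e2 := e1.sub (hab x)
    simp only [cexpI_zero, mul_one, add_sub_cancel_left] at e2
    simp only [hd0 0 (by omega) (by omega), sub_zero]
    refine e2.congr' ?_
    filter_upwards [eventually_ge_atTop N] with L hL
    have e3 : ∑ l ∈ Finset.Ico N L, (a l * (Real.cos (l * x) : ℂ) + b l * (Real.sin (l * x) : ℂ))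
        = ∑ l ∈ Finset.range L, (d l * cexpI l x + d (-l) * cexpI (-l) x) := by
      rw [Finset.range_eq_Ico, ← Finset.sum_Ico_consecutive _ (Nat.zero_le N) hL,
        Finset.sum_eq_zero (s := Finset.Ico 0 N) fun l hl => ?_, zero_add]
      · refine Finset.sum_congr rfl fun l hl => ?_
        have hl' := Finset.mem_Ico.1 hl
        have d1 : d l = (a l - b l * Complex.I) / 2 := by
          simp only [hd]
          rw [if_pos (by omega), Int.toNat_natCast]
        have d2 : d (-l) = (a l + b l * Complex.I) / 2 := by
          simp only [hd]
          rw [if_neg (by omega), if_pos (by omega), neg_neg, Int.toNat_natCast]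
        rw [d1, d2, cexpI_neg_left, cexpI_eq_cos_add_sin, cexpI_eq_cos_add_sin, mul_neg,
          Real.cos_neg, Real.sin_neg, Int.cast_natCast]
        push_cast
        linear_combination (b l * Complex.sin (l * x)) * Complex.I_sq
      · have hl' := Finset.mem_Ico.1 hl
        rw [hd0 l (by omega) (by omega), hd0 (-l) (by omega) (by omega)]
        simp
    rw [e3, ← Finset.sum_sub_distrib]
    refine Finset.sum_congr rfl fun l _ => ?_
    ring

/-- The Fourier coefficients of the real part of a power series on the unit circle. -/
noncomputable def reCoeff (f : PowerSeries ℂ) (q : ℤ) : ℂ :=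
  (if 0 ≤ q then PowerSeries.coeff q.toNat f / 2 else 0)
    + if q ≤ 0 then (starRingEnd ℂ) (PowerSeries.coeff (-q).toNat f) / 2 else 0

theorem hasSum_reCoeff {f : PowerSeries ℂ} (hf : f.AbsSummable) (x : ℝ) :
    HasSum (fun q : ℤ => reCoeff f q * cexpI q x)
      ((f.sumAt (Complex.exp (Complex.I * x))).re : ℂ) := by
  have h := hf.hasSum (norm_exp_I_mul x).le
  have hinj : Function.Injective fun l : ℕ => -(l : ℤ) := fun a b h => by simpa using h
  have h1 : HasSum (fun q : ℤ => (if 0 ≤ q then PowerSeries.coeff q.toNat f / 2 else 0)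
      * cexpI q x) (f.sumAt (Complex.exp (Complex.I * x)) / 2) := by
    refine (Nat.cast_injective.hasSum_iff (f := fun q : ℤ =>
      (if 0 ≤ q then PowerSeries.coeff q.toNat f / 2 else 0) * cexpI q x) fun q hq => ?_).1 ?_
    · rw [if_neg fun h0 => hq ⟨q.toNat, Int.toNat_of_nonneg h0⟩, zero_mul]
    · refine (h.div_const 2).congr_fun fun l => ?_
      simp only [Function.comp, Nat.cast_nonneg, if_true, Int.toNat_natCast, cexpI_natCast]
      ring
  have h2 : HasSum (fun q : ℤ => (if q ≤ 0 then (starRingEnd ℂ) (PowerSeries.coeff (-q).toNat f) / 2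
      else 0) * cexpI q x) ((starRingEnd ℂ) (f.sumAt (Complex.exp (Complex.I * x))) / 2) := by
    refine (hinj.hasSum_iff (f := fun q : ℤ =>
      (if q ≤ 0 then (starRingEnd ℂ) (PowerSeries.coeff (-q).toNat f) / 2 else 0) * cexpI q x)
      fun q hq => ?_).1 ?_
    · rw [if_neg fun h0 => hq ⟨(-q).toNat, by simp only; omega⟩, zero_mul]
    · refine (((Complex.hasSum_conj').2 h).div_const 2).congr_fun fun l => ?_
      simp only [Function.comp, Left.neg_nonpos_iff, Nat.cast_nonneg, if_true, neg_neg,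
        Int.toNat_natCast]
      rw [← cexpI_natCast, map_mul, conj_cexpI]
      ring
  have h3 := h1.add h2
  rw [← add_div, Complex.add_conj, mul_comm, Complex.ofReal_mul, Complex.ofReal_ofNat,
    mul_div_assoc, div_self two_ne_zero, mul_one] at h3
  refine h3.congr_fun fun q => ?_
  rw [reCoeff, add_mul]

theorem reCoeff_eq_zero {f : PowerSeries ℂ} {N : ℕ} (hN : ∀ l < N, PowerSeries.coeff l f = 0)
    {q : ℤ} (h1 : -(N : ℤ) < q) (h2 : q < N) : reCoeff f q = 0 := by
  rw [reCoeff, hN q.toNat (by omega), hN (-q).toNat (by omega)]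
  simp

theorem reCoeff_natCast (f : PowerSeries ℂ) {l : ℕ} (hl : 0 < l) :
    reCoeff f l = PowerSeries.coeff l f / 2 := by
  rw [reCoeff, if_pos (by omega), if_neg (by omega), Int.toNat_natCast, add_zero]

theorem reCoeff_neg_natCast (f : PowerSeries ℂ) {l : ℕ} (hl : 0 < l) :
    reCoeff f (-l) = (starRingEnd ℂ) (PowerSeries.coeff l f) / 2 := by
  rw [reCoeff, if_neg (by omega), if_pos (by omega), neg_neg, Int.toNat_natCast, zero_add]

theorem hasSum_trigPoly_mul {d : ℕ} {u : ℤ → ℂ} {ρ : ℤ → ℂ} {x : ℝ} {s : ℂ}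
    (h : HasSum (fun q : ℤ => ρ q * cexpI q x) s) :
    HasSum (fun q : ℤ => (∑ p ∈ Finset.Icc (-(d : ℤ)) d, u p * ρ (q - p)) * cexpI q x)
      ((∑ p ∈ Finset.Icc (-(d : ℤ)) d, u p * cexpI p x) * s) := by
  rw [Finset.sum_mul]
  simp only [Finset.sum_mul]
  refine hasSum_sum fun p _ => ?_
  have h1 := ((Equiv.subRight p).hasSum_iff.2 h).mul_left (u p * cexpI p x)
  refine h1.congr_fun fun q => ?_
  simp only [Function.comp, Equiv.subRight_apply]
  rw [show cexpI q x = cexpI p x * cexpI (q - p) x by rw [← cexpI_add]; congr 1; ring]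
  ring

theorem hasSum_trigPoly (d : ℕ) (t : ℤ → ℂ) (x : ℝ) :
    HasSum (fun q : ℤ => (if q ∈ Finset.Icc (-(d : ℤ)) d then t q else 0) * cexpI q x)
      (∑ p ∈ Finset.Icc (-(d : ℤ)) d, t p * cexpI p x) := by
  have h : HasSum (fun q : ℤ => (if q ∈ Finset.Icc (-(d : ℤ)) d then t q else 0) * cexpI q x)
      (∑ q ∈ Finset.Icc (-(d : ℤ)) d,
        (if q ∈ Finset.Icc (-(d : ℤ)) d then t q else 0) * cexpI q x) :=
    hasSum_sum_of_ne_finset_zero fun q hq => by rw [if_neg hq, zero_mul]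
  rwa [Finset.sum_congr rfl fun p hp => by rw [if_pos hp]] at h

theorem IsTrigPoly.analyticOnNhd {d : ℕ} {T : ℝ → ℂ} (hT : IsTrigPoly d T) :
    AnalyticOnNhd ℝ T Set.univ := by
  obtain ⟨u, hu⟩ := hT
  have e : T = fun x : ℝ => ∑ p ∈ Finset.Icc (-(d : ℤ)) d, u p * Complex.exp (Complex.I * p * x) :=
    funext hu
  rw [e]
  refine Finset.analyticOnNhd_fun_sum _ fun p _ x _ => ?_
  have h1 : AnalyticAt ℝ (fun x : ℝ => (x : ℂ)) x := Complex.ofRealCLM.analyticAt x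
  have h2 : AnalyticAt ℂ (fun z : ℂ => u p * Complex.exp (Complex.I * p * z)) (x : ℂ) := by
    fun_prop
  exact (h2.restrictScalars (𝕜 := ℝ)).comp h1

/-- A trigonometric polynomial times a function with no frequencies below `N` in absolute value
has again this property only if the polynomial is constant. -/
theorem coeff_eq_zero_of_forall_sum_eq_zero {d N : ℕ} (hd : d < N) {u ρ : ℤ → ℂ}
    (hρ : ∀ q : ℤ, -(N : ℤ) < q → q < N → ρ q = 0) (hN : ρ N ≠ 0)
    (h : ∀ q : ℤ, 0 < q → q < N → ∑ p ∈ Finset.Icc (-(d : ℤ)) d, u p * ρ (q - p) = 0) :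
    ∀ s : ℕ, 0 < s → s ≤ d → u (-s) = 0 := by
  -- Downward induction on s = d - i. At the frequency N - s only u_{-s} ρ_N survives: smaller
  -- indices p have u_p = 0 already, and larger ones meet ρ inside its gap.
  have key : ∀ i : ℕ, i < d → u (-((d - i : ℕ) : ℤ)) = 0 := by
    intro i
    induction i using Nat.strong_induction_on with
    | _ i ih =>
      intro hi
      have h0 := h (N - (d - i : ℕ)) (by omega) (by omega)
      rw [Finset.sum_eq_single (-((d - i : ℕ) : ℤ))] at h0
      · rw [sub_neg_eq_add, sub_add_cancel] at h0
        exact (mul_eq_zero.1 h0).resolve_right hN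
      · intro p hp hne
        have hp' := Finset.mem_Icc.1 hp
        rcases lt_or_gt_of_ne hne with hlt | hgt
        · have := ih (d - (-p).toNat) (by omega) (by omega)
          rw [show (-((d - (d - (-p).toNat) : ℕ) : ℤ)) = p by omega] at this
          rw [this, zero_mul]
        · rw [hρ _ (by omega) (by omega), mul_zero]
      · intro hp
        exact absurd (Finset.mem_Icc.2 ⟨by omega, by omega⟩) hp
  intro s hs hsd
  have := key (d - s) (by omega)
  rwa [show d - (d - s) = s by omega] at this

section

variable {k : ℕ} {γ : ℝ} {lam : Fin k → ℝ} {n : ℕ} {m : Fin k → ℕ} {Q : ℂ[X]} {P : Fin k → ℂ[X]}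

/-- The definition compares the fractions only where the denominator is nonzero. By analyticity a
nonzero S vanishes on no open set, so continuity extends the equality to all x. -/
theorem eq_mul_of_isTrigPoly {d e : ℕ} {S T r : ℝ → ℂ} (hS : IsTrigPoly d S) (hS0 : S ≠ 0)
    (hT : IsTrigPoly e T) (hr : Continuous r) (h : ∀ x, S x ≠ 0 → r x = T x / S x) (x : ℝ) :
    T x = S x * r x := by
  by_contra hne
  have hSc : Continuous S := by
    rw [← continuousOn_univ]; exact hS.analyticOnNhd.continuousOn
  have hTc : Continuous T := by
    rw [← continuousOn_univ]; exact hT.analyticOnNhd.continuousOn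
  have hev : ∀ᶠ y in 𝓝 x, T y ≠ S y * r y :=
    (isOpen_ne_fun hTc (hSc.mul hr)).mem_nhds hne
  have hS' : S =ᶠ[𝓝 x] 0 := by
    filter_upwards [hev] with y hy
    by_contra hSy
    refine hy ?_
    rw [h y hSy, mul_div_cancel₀ _ hSy]
  exact hS0 (funext fun y => hS.analyticOnNhd.eqOn_zero_of_preconnected_of_eventuallyEq_zero
    isPreconnected_univ (Set.mem_univ x) hS' (Set.mem_univ y))

/-- The fraction `Re (P_j / Q)` is not a trigonometric Hermite–Padé approximation if the leading
coefficient of the `j`-th remainder is not zero. -/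
theorem not_isTrigHermitePadeApprox (hγ : ∀ p : ℕ, γ ≠ -(p : ℝ)) (hm : ∀ j, m j ≤ n)
    (hQ : ∀ z : ℂ, ‖z‖ ≤ 1 → Q.eval z ≠ 0)
    (h : IsHermitePade (systemE γ lam) n m Q P) {j : Fin k} (hj : 0 < m j) (hlamj : lam j ≠ 0)
    (hc : PowerSeries.coeff (n + ∑ i, m i + 1) ((Q : PowerSeries ℂ) * systemE γ lam j) ≠ 0) :
    ¬ IsTrigHermitePadeApprox (systemG γ lam) n m j
      (fun x => (((P j).eval (Complex.exp (Complex.I * x))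
        * (starRingEnd ℂ) (Q.eval (Complex.exp (Complex.I * x)))).re : ℂ)
        / (Q.eval (Complex.exp (Complex.I * x))
          * (starRingEnd ℂ) (Q.eval (Complex.exp (Complex.I * x))))) := by
  rintro ⟨S, T, ⟨hS0, hSpoly, hST⟩, hr⟩
  have hjac := isTrigHermiteJacobi_re hm hQ h
  set r : ℝ → ℂ := fun x => (((P j).eval (Complex.exp (Complex.I * x))
        * (starRingEnd ℂ) (Q.eval (Complex.exp (Complex.I * x)))).re : ℂ)
        / (Q.eval (Complex.exp (Complex.I * x))
          * (starRingEnd ℂ) (Q.eval (Complex.exp (Complex.I * x)))) with hrdef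
  have hmj := hm j
  have hmM : m j ≤ ∑ i, m i := Finset.single_le_sum (f := m) (fun _ _ => Nat.zero_le _)
    (Finset.mem_univ j)
  obtain ⟨hTpoly, hser⟩ := hST j
  obtain ⟨A, R, hA, hR, hAz, hRA, hQR, hR0⟩ := exists_remainder hQ h j
  set M := ∑ i, m i with hM
  have hrc : Continuous r := by
    have c1 : Continuous fun x : ℝ => ((((P j).eval (Complex.exp (Complex.I * x))
        * (starRingEnd ℂ) (Q.eval (Complex.exp (Complex.I * x)))).re : ℝ) : ℂ) := by
      rw [← continuousOn_univ]
      exact ((hjac.2.2 j).1.analyticOnNhd).continuousOn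
    have c2 : Continuous fun x : ℝ => Q.eval (Complex.exp (Complex.I * x))
          * (starRingEnd ℂ) (Q.eval (Complex.exp (Complex.I * x))) := by
      rw [← continuousOn_univ]
      exact hjac.2.1.analyticOnNhd.continuousOn
    exact c1.div c2 hjac.1
  have hTS := eq_mul_of_isTrigPoly hSpoly hS0 hTpoly hrc hr
  obtain ⟨u, hu⟩ := hSpoly
  obtain ⟨t, ht⟩ := hTpoly
  have hu' : ∀ x, S x = ∑ p ∈ Finset.Icc (-(M : ℤ)) M, u p * cexpI p x := hu
  have ht' : ∀ x, T j x = ∑ p ∈ Finset.Icc (-((n + M - m j : ℕ) : ℤ)) (n + M - m j : ℕ),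
    t p * cexpI p x := ht
  have hrem : ∀ x, (systemG γ lam j x : ℂ) - r x
      = ((R.sumAt (Complex.exp (Complex.I * x))).re : ℂ) := by
    intro x
    simp only [hrdef]
    rw [re_mul_conj_div, hRA, (absSummable_systemE γ lam j).sumAt_sub hA (norm_exp_I_mul _).le,
      hAz _ (norm_exp_I_mul _).le, Complex.sub_re, ← systemG_eq_re, Complex.ofReal_sub]
  -- The same function S G - T_j is expanded twice: through the remainder, to show that S is
  -- constant, and through G itself, to show that the constant is zero.
  have hsum1 : ∀ x, HasSum (fun q : ℤ =>
      (∑ p ∈ Finset.Icc (-(M : ℤ)) M, u p * reCoeff R (q - p)) * cexpI q x)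
      (S x * (systemG γ lam j x : ℂ) - T j x) := by
    intro x
    rw [hTS x, ← mul_sub, hrem x, hu' x]
    exact hasSum_trigPoly_mul (hasSum_reCoeff hR x)
  have hsum2 : ∀ x, HasSum (fun q : ℤ =>
      (∑ p ∈ Finset.Icc (-(M : ℤ)) M, u p * reCoeff (systemE γ lam j) (q - p)
        - if q ∈ Finset.Icc (-((n + M - m j : ℕ) : ℤ)) (n + M - m j : ℕ) then t q else 0)
        * cexpI q x) (S x * (systemG γ lam j x : ℂ) - T j x) := by
    intro x
    have h1 := hasSum_trigPoly_mul (d := M) (u := u)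
      (hasSum_reCoeff (absSummable_systemE γ lam j) x)
    rw [← hu' x, ← systemG_eq_re] at h1
    have h2 := h1.sub (hasSum_trigPoly (n + M - m j) t x)
    rw [← ht' x] at h2
    simpa only [sub_mul] using h2
  have hz1 : ∀ q : ℤ, -((n + M + 1 : ℕ) : ℤ) < q → q < (n + M + 1 : ℕ) →
      ∑ p ∈ Finset.Icc (-(M : ℤ)) M, u p * reCoeff R (q - p) = 0 := fun q h1 h2 =>
    hser.coeff_eq_zero (Nat.succ_pos _) hsum1 h1 h2
  -- `R` starts at this index and P_j does not reach it, so if this coefficient vanished, the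
  -- corresponding one of Q E_γ(λ_j z) would vanish too.
  have hRne : PowerSeries.coeff (n + M + 1) R ≠ 0 := by
    intro h0
    refine hc ?_
    have h1 : PowerSeries.coeff (n + M + 1) ((Q : PowerSeries ℂ) * R) = 0 := by
      rw [PowerSeries.coeff_mul]
      refine Finset.sum_eq_zero fun p hp => ?_
      have := Finset.HasAntidiagonal.mem_antidiagonal.1 hp
      rcases Nat.lt_or_ge (n + M) p.2 with h2 | h2
      · rw [show p.2 = n + M + 1 by omega, h0, mul_zero]
      · rw [hR0 _ h2, mul_zero]
    have h2 := (h.2.2 j).1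
    rwa [hQR, map_sub, Polynomial.coeff_coe, coeff_eq_zero_of_natDegree_lt (by omega),
      sub_zero] at h1
  have hρ0 : ∀ q : ℤ, -((n + M + 1 : ℕ) : ℤ) < q → q < (n + M + 1 : ℕ) → reCoeff R q = 0 :=
    fun q h1 h2 => reCoeff_eq_zero (fun l hl => hR0 l (by omega)) h1 h2
  have hneg : ∀ s : ℕ, 0 < s → s ≤ M → u (-s) = 0 := by
    refine coeff_eq_zero_of_forall_sum_eq_zero (N := n + M + 1) (by omega) hρ0 ?_
      fun q h1 h2 => hz1 q (by omega) h2
    rw [reCoeff_natCast _ (Nat.succ_pos _)]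
    exact div_ne_zero hRne two_ne_zero
  have hpos : ∀ s : ℕ, 0 < s → s ≤ M → u s = 0 := by
    -- The positive frequencies follow from the negative ones by reflecting p to -p.
    have := coeff_eq_zero_of_forall_sum_eq_zero (N := n + M + 1) (d := M) (u := fun p => u (-p))
      (ρ := fun p => reCoeff R (-p)) (by omega)
      (fun q h1 h2 => hρ0 _ (by omega) (by omega)) ?_ fun q h1 h2 => ?_
    · simpa using this
    · rw [reCoeff_neg_natCast _ (Nat.succ_pos _)]
      exact div_ne_zero ((_root_.map_ne_zero _).2 hRne) two_ne_zero
    · rw [← hz1 (-q) (by omega) (by omega)]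
      refine Finset.sum_nbij' (fun p => -p) (fun p => -p) ?_ ?_ ?_ ?_ ?_
      · intro p hp; have := Finset.mem_Icc.1 hp; exact Finset.mem_Icc.2 ⟨by omega, by omega⟩
      · intro p hp; have := Finset.mem_Icc.1 hp; exact Finset.mem_Icc.2 ⟨by omega, by omega⟩
      · intro p _; exact neg_neg p
      · intro p _; exact neg_neg p
      · intro p _; congr 2; ring
  have hzero : ∀ p ∈ Finset.Icc (-(M : ℤ)) M, p ≠ 0 → u p = 0 := by
    intro p hp hp0
    have hp' := Finset.mem_Icc.1 hp
    obtain ⟨s, rfl | rfl⟩ := p.eq_nat_or_neg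
    · exact hpos s (by omega) (by omega)
    · exact hneg s (by omega) (by omega)
  have hmem0 : (0 : ℤ) ∈ Finset.Icc (-(M : ℤ)) M := Finset.mem_Icc.2 ⟨by omega, by omega⟩
  have hu0 : u 0 = 0 := by
    -- The frequency n + M is below n + M + 1, and above the degree n + M - m_j of T_j because m_j >
    -- 0.
    have h1 := hser.coeff_eq_zero (Nat.succ_pos _) hsum2 (q := ((n + M : ℕ) : ℤ)) (by omega)
      (by omega)
    rw [if_neg (fun h => by have := (Finset.mem_Icc.1 h).2; omega), sub_zero,
      Finset.sum_eq_single_of_mem 0 hmem0 (fun p hp hp0 => by rw [hzero p hp hp0, zero_mul]),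
      sub_zero, reCoeff_natCast _ (by omega), coeff_systemE] at h1
    refine (mul_eq_zero.1 h1).resolve_right (div_ne_zero (div_ne_zero (pow_ne_zero _ ?_) ?_)
      two_ne_zero)
    · exact_mod_cast hlamj
    · exact_mod_cast risingFact_ne_zero hγ _
  refine hS0 (funext fun x => ?_)
  rw [hu' x]
  refine Finset.sum_eq_zero fun p hp => ?_
  rcases eq_or_ne p 0 with rfl | hp0
  · rw [hu0, zero_mul]
  · rw [hzero p hp hp0, zero_mul]

end

/-- The leading coefficient of the remainder is not zero at the smallest node. -/
theorem sum_nodePoly_div_ne_zero {k : ℕ} {lam : Fin k → ℝ} {m : Fin k → ℕ} {a : ℝ} (ha : 0 < a)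
    {j : Fin k} (hpos : 0 < lam j) (hmin : ∀ i, m i ≠ 0 → lam j ≤ lam i) :
    ∑ p ∈ Finset.range (∑ i, m i + 1), (nodePoly lam m).coeff p / (a + p) * lam j ^ p ≠ 0 := by
  intro h0
  have hap : ∀ p : ℕ, 0 < a + p := fun p => by positivity
  -- This is the integral of s^{a-1} ∏ (s - λ_p)^{m_p} from 0 to t. If it vanished at `lam j`,
  -- Rolle's theorem would give a node with nonzero multiplicity strictly between 0 and `lam j`.
  set f : ℝ → ℝ := fun t => ∑ p ∈ Finset.range (∑ i, m i + 1),
    (nodePoly lam m).coeff p / (a + p) * t ^ (a + p) with hf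
  have hf0 : f 0 = 0 := by
    simp only [hf]
    refine Finset.sum_eq_zero fun p _ => ?_
    rw [Real.zero_rpow (hap p).ne', mul_zero]
  have hf1 : f (lam j) = 0 := by
    have : f (lam j) = lam j ^ a * ∑ p ∈ Finset.range (∑ i, m i + 1),
        (nodePoly lam m).coeff p / (a + p) * lam j ^ p := by
      simp only [hf, Finset.mul_sum]
      refine Finset.sum_congr rfl fun p _ => ?_
      rw [Real.rpow_add hpos, Real.rpow_natCast]
      ring
    rw [this, h0, mul_zero]
  have hcont : ContinuousOn f (Set.Icc 0 (lam j)) := by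
    refine Continuous.continuousOn (continuous_finsetSum _ fun p _ => continuous_const.mul ?_)
    exact Real.continuous_rpow_const (hap p).le
  have hderiv : ∀ t ∈ Set.Ioo 0 (lam j), HasDerivAt f
      (t ^ (a - 1) * (nodePoly lam m).eval t) t := by
    intro t ht
    have h1 : HasDerivAt f (∑ p ∈ Finset.range (∑ i, m i + 1),
        (nodePoly lam m).coeff p / (a + p) * ((a + p) * t ^ (a + p - 1))) t :=
      HasDerivAt.fun_sum fun p _ => (Real.hasDerivAt_rpow_const (Or.inl ht.1.ne')).const_mul _
    refine h1.congr_deriv ?_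
    rw [eval_eq_sum_range, natDegree_nodePoly, Finset.mul_sum]
    refine Finset.sum_congr rfl fun p _ => ?_
    have := (hap p).ne'
    rw [show a + p - 1 = a - 1 + p by ring, Real.rpow_add ht.1, Real.rpow_natCast]
    field_simp
  obtain ⟨t, ht, h⟩ := exists_hasDerivAt_eq_zero hpos hcont (by rw [hf0, hf1]) hderiv
  rcases mul_eq_zero.1 h with h | h
  · exact (Real.rpow_pos_of_pos ht.1 _).ne' h
  · rw [nodePoly, eval_prod, Finset.prod_eq_zero_iff] at h
    obtain ⟨i, -, hi⟩ := h
    rw [eval_pow, eval_sub, eval_X, eval_C, pow_eq_zero_iff'] at hi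
    have := hmin i hi.2
    linarith [hi.1, ht.2]

/-! ### Assembly of the theorem -/

theorem ofReal_cos_add_I_mul_sin (x : ℝ) :
    ((Real.cos x : ℂ) + Complex.I * Real.sin x) = Complex.exp (Complex.I * x) := by
  rw [mul_comm Complex.I (x : ℂ), Complex.exp_mul_I, Complex.ofReal_cos, Complex.ofReal_sin]
  ring

/-- The squared modulus of the denominator in terms of the sum of Gamma integrals. -/
theorem eval_mul_conj_eval_hermitePadeDen {k : ℕ} {γ : ℝ} (hγ : ∀ p : ℕ, γ ≠ -(p : ℝ))
    (lam : Fin k → ℝ) (n : ℕ) (m : Fin k → ℕ) (hN : 0 < n + (∑ i, m i : ℕ) + γ) {r z : ℂ}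
    (hr : ‖r‖ = 1) (hz : z = ∑ p ∈ Finset.range (∑ i, m i + 1), ((nodePoly lam m).coeff p : ℂ)
      * ((r⁻¹) ^ ((n + p + γ : ℝ) : ℂ) * (Real.Gamma (n + p + γ) : ℂ))) :
    (hermitePadeDen γ lam n m).eval r * (starRingEnd ℂ) ((hermitePadeDen γ lam n m).eval r)
      = ((1 / Real.Gamma (n + (∑ i, m i : ℕ) + γ) ^ 2 * ‖z‖ ^ 2 : ℝ) : ℂ) := by
  rw [hz, norm_sum_cpow_mul_Gamma hγ lam n m hN hr, mul_pow, ← mul_assoc, one_div,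
    inv_mul_cancel₀ (pow_ne_zero 2 (Real.Gamma_pos_of_pos hN).ne'), one_mul, Complex.mul_conj']
  push_cast
  rfl

theorem theorem4 (k : ℕ) (γ : ℝ) (hγ : ∀ p : ℕ, γ ≠ -(p : ℝ))
    (lam : Fin k → ℝ) (hlam : Function.Injective lam) (hlam0 : ∀ j, lam j ≠ 0) :
    ∃ n₀ : ℕ, ∀ n ≥ n₀, ∀ m : Fin k → ℕ, m ≠ 0 → (∀ j, m j ≤ n) →
      -- `Q` is the Hermite–Padé denominator of `E_{k,γ}`, unique when normalized by `Q(0) = 1`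
      ∃ Q : ℂ[X], (∃ P, IsHermitePade (systemE γ lam) n m Q P) ∧ Q.eval 0 = 1 ∧
        (∀ Q' P', IsHermitePade (systemE γ lam) n m Q' P' → ∃ c : ℂ, Q' = C c * Q) ∧
        ∃ (Qt : ℝ → ℂ) (Pt : Fin k → ℝ → ℂ),
          IsTrigHermiteJacobi (systemG γ lam) n m Qt Pt ∧
          (∀ x : ℝ, Qt x = Q.eval (Complex.exp (Complex.I * x)) *
            (starRingEnd ℂ) (Q.eval (Complex.exp (Complex.I * x)))) ∧
          -- the integral over the positive half-line, where it converges
          (∀ x : ℝ, 0 < Real.cos x →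
            IntegrableOn (fun t : ℝ => kernelU γ lam n m t *
              Complex.exp (-t * (Real.cos x + Complex.I * Real.sin x))) (Set.Ioi 0) ∧
            Qt x = ((1 / Real.Gamma (n + (∑ i, m i : ℕ) + γ) ^ 2 *
              ‖∫ t in Set.Ioi (0 : ℝ), kernelU γ lam n m t *
                Complex.exp (-t * (Real.cos x + Complex.I * Real.sin x))‖ ^ 2 : ℝ) : ℂ)) ∧
          -- for every real `x`: the same integral over the ray `t = s e^{-ix}`, `s > 0`
          (∀ x : ℝ,
            IntegrableOn (fun s : ℝ => kernelU γ lam n m (s * Complex.exp (-(Complex.I * x))) *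
              Complex.exp (-s) * Complex.exp (-(Complex.I * x))) (Set.Ioi 0) ∧
            Qt x = ((1 / Real.Gamma (n + (∑ i, m i : ℕ) + γ) ^ 2 *
              ‖∫ s in Set.Ioi (0 : ℝ), kernelU γ lam n m (s * Complex.exp (-(Complex.I * x))) *
                Complex.exp (-s) * Complex.exp (-(Complex.I * x))‖ ^ 2 : ℝ) : ℂ)) ∧
          ((∀ j, 0 < lam j) → StrictMono lam →
            ∃ j, ¬ IsTrigHermitePadeApprox (systemG γ lam) n m j (fun x => Pt j x / Qt x)) := by
  obtain ⟨n₁, hn₁⟩ := exists_nat_gt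
    ((∑ j, |lam j|) * Real.exp (4 * ∑ j, |lam j|) + 1 - γ)
  -- `n₁` gives Λ e^{4Λ} < n + γ - 1, a condition free of `m`; n ≥ 1 keeps the index n + M - (p + 1)
  -- from being truncated when p = M.
  refine ⟨max 1 n₁, fun n hn m hm0 hm => ?_⟩
  set Λ : ℝ := ∑ j, |lam j| with hΛdef
  have hΛ0 : 0 ≤ Λ := Finset.sum_nonneg fun _ _ => abs_nonneg _
  have hΛ : ∀ j, |lam j| ≤ Λ := fun j =>
    Finset.single_le_sum (f := fun j => |lam j|) (fun _ _ => abs_nonneg _) (Finset.mem_univ j)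
  have hn1 : 1 ≤ n := (le_max_left _ _).trans hn
  have hnn : (n₁ : ℝ) ≤ n := by exact_mod_cast (le_max_right _ _).trans hn
  have ha : Λ * Real.exp (4 * Λ) < n + γ - 1 := by linarith
  have ha0 : 0 < n + γ - 1 := lt_of_le_of_lt (by positivity) ha
  have hN : 0 < n + ((∑ i, m i : ℕ) : ℝ) + γ := by
    have : (0 : ℝ) ≤ (∑ i, m i : ℕ) := Nat.cast_nonneg _
    linarith
  have hQ : ∀ z : ℂ, ‖z‖ ≤ 1 → (hermitePadeDen γ lam n m).eval z ≠ 0 := fun z hz =>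
    hermitePadeDen_eval_ne_zero hγ lam hn1 m hΛ0 hΛ ha hz
  obtain ⟨P, hP⟩ := exists_isHermitePade hγ lam n m hlam0 hm
  refine ⟨hermitePadeDen γ lam n m, ⟨P, hP⟩, eval_zero_hermitePadeDen hγ lam n m,
    fun Q' P' h => h.eq_C_mul hγ lam n m hlam hlam0 hm, _, _,
    isTrigHermiteJacobi_re hm hQ hP, fun x => rfl, fun x hx => ?_, fun x => ?_,
    fun hpos _ => ?_⟩
  · simp only [ofReal_cos_add_I_mul_sin]
    have hre : 0 < (Complex.exp (Complex.I * x)).re := by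
      rw [← ofReal_cos_add_I_mul_sin]
      simpa [← Complex.ofReal_cos, ← Complex.ofReal_sin] using hx
    obtain ⟨h1, h2⟩ := integral_kernelU_Ioi (γ := γ) lam n m (by linarith) hre
    exact ⟨h1, eval_mul_conj_eval_hermitePadeDen hγ lam n m hN (norm_exp_I_mul x) h2⟩
  · obtain ⟨h1, h2⟩ := integral_kernelU_ray (γ := γ) lam n m (by linarith)
      (Complex.exp_ne_zero (-(Complex.I * x)))
    refine ⟨h1, eval_mul_conj_eval_hermitePadeDen hγ lam n m hN (norm_exp_I_mul x) ?_⟩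
    rw [← Complex.exp_neg]
    exact h2
  · obtain ⟨i₀, hi₀⟩ := Function.ne_iff.1 hm0
    -- The minimum is taken only over nodes that occur: then m_j > 0, and the kernel has no zero
    -- between 0 and λ_j.
    obtain ⟨j, hj, hmin⟩ := Finset.exists_min_image (Finset.univ.filter fun i => m i ≠ 0) lam
      ⟨i₀, by simpa using hi₀⟩
    simp only [Finset.mem_filter, Finset.mem_univ, true_and] at hj hmin
    refine ⟨j, not_isTrigHermitePadeApprox hγ hm hQ hP (Nat.pos_of_ne_zero hj) (hlam0 j) ?_⟩
    rw [coeff_hermitePadeDen_mul_systemE_succ hγ]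
    have h1 := sum_nodePoly_div_ne_zero (m := m) (a := γ + n) (by linarith) (hpos j) hmin
    exact_mod_cast mul_ne_zero
      (div_ne_zero (pow_ne_zero _ (hlam0 j)) (risingFact_ne_zero hγ _)) h1
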